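/- For $r\in(0,1)$ let $A_r=\{z\in\mathbb{C}: r<|z|<1\}$. For a $C^\infty$-smoothly bounded planar domain $\Omega$ let $H^2(b\Omega)$ be the closure in $L^2(b\Omega)$ (with respect to arc length $ds$) of the boundary traces of functions holomorphic on $\Omega$ and smooth on $\overline\Omega$, its elements being identified with their holomorphic extensions to $\Omega$; let $S_\Omega(z,\zeta)$ be its reproducing kernel (the Szegő kernel), put $S_\Omega(z)=S_\Omega(z,z)$, and let $$s_\Omega(z)=\sqrt{\frac{\partial^2\log S_\Omega(z)}{\partial z\,\partial\bar z}}$$ be the density of the Szegő metric $s_\Omega(z)|dz|$. The Gaussian curvature of a $C^2$-smooth conformal metric $m(z)|dz|$ is $\kappa_m(z)=-\Delta\log m(z)/m(z)^2$. **Theorem.** There exist a $C^\infty$-smoothly bounded domain $\Omega\subset\mathbb{C}$, which can be taken to be an annulus $\Omega=A_r$ for some $r\in(0,1)$, and points $z,w\in\Omega$ such that the Szegő kernel of $\Omega$ exists, $s_\Omega(z)|dz|$ is a $C^2$-smooth conformal metric on $\Omega$ (with $s_\Omega>0$), and $$\kappa_{s_\Omega}(z)>0\quad\text{and}\quad \kappa_{s_\Omega}(w)<0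 .$$ -/

import Mathlib

open MeasureTheory Set Filter Topology
open scoped ContDiff

noncomputable section

namespace SzegoMetric

/-- A `C^∞`-smoothly bounded planar domain: a nonempty connected bounded open set which, near each
of its boundary points, is the sublevel set `{ρ < 0}` of a smooth real function `ρ` with
non-vanishing differential. -/
structure IsSmoothlyBoundedDomain (Ω : Set ℂ) : Prop where
  isOpen : IsOpen Ω
  isConnected : IsConnected Ω
  isBounded : Bornology.IsBounded Ω
  smooth_boundary : ∀ p ∈ frontier Ω, ∃ U : Set ℂ, IsOpen U ∧ p ∈ U ∧ ∃ ρ : ℂ → ℝ,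
    ContDiffOn ℝ ∞ ρ U ∧ (∀ z ∈ U, fderiv ℝ ρ z ≠ 0) ∧ Ω ∩ U = {z ∈ U | ρ z < 0}

/-- The annulus `A_r = {z : r < |z| < 1}`. -/
def annulus (r : ℝ) : Set ℂ := {z : ℂ | r < ‖z‖ ∧ ‖z‖ < 1}

/-- Arc length on the boundary `bΩ`: one-dimensional Hausdorff measure restricted to `bΩ`. -/
def arcLength (Ω : Set ℂ) : Measure ℂ :=
  (Measure.hausdorffMeasure 1 : Measure ℂ).restrict (frontier Ω)

/-- `f` is holomorphic on `Ω` and smooth on the closure of `Ω`. -/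
def IsSmoothHolomorphic (Ω : Set ℂ) (f : ℂ → ℂ) : Prop :=
  DifferentiableOn ℂ f Ω ∧ ContDiffOn ℝ ∞ f (closure Ω)

/-- The boundary traces in `L²(bΩ)` of the functions which are holomorphic on `Ω` and smooth on
the closure of `Ω`. -/
def smoothTraces (Ω : Set ℂ) : Submodule ℂ (Lp ℂ 2 (arcLength Ω)) where
  carrier := {h | ∃ f : ℂ → ℂ, IsSmoothHolomorphic Ω f ∧ h =ᵐ[arcLength Ω] f}
  zero_mem' := ⟨0, ⟨differentiableOn_const 0, contDiffOn_const⟩, Lp.coeFn_zero _ _ _⟩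
  add_mem' := by
    rintro a b ⟨f, hf, haf⟩ ⟨g, hg, hbg⟩
    exact ⟨f + g, ⟨hf.1.add hg.1, hf.2.add hg.2⟩, (Lp.coeFn_add a b).trans (haf.add hbg)⟩
  smul_mem' := by
    rintro c a ⟨f, hf, haf⟩
    exact ⟨c • f, ⟨hf.1.const_smul c, hf.2.const_smul c⟩,
      (Lp.coeFn_smul c a).trans (haf.const_smul c)⟩

/-- The Hardy space `H²(bΩ)`: the closure in `L²(bΩ)` of the smooth holomorphic boundary traces. -/
def hardySpace (Ω : Set ℂ) : Submodule ℂ (Lp ℂ 2 (arcLength Ω)) :=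
  (smoothTraces Ω).topologicalClosure

/-- `F` is (on `Ω`) the holomorphic extension of the element `h` of `H²(bΩ)`: there are functions
`f n`, holomorphic on `Ω` and smooth on its closure, whose boundary traces converge to `h` in
`L²(bΩ)` and which converge to `F` locally uniformly on `Ω`. -/
def IsHolomorphicExtension (Ω : Set ℂ) (h : Lp ℂ 2 (arcLength Ω)) (F : ℂ → ℂ) : Prop :=
  ∃ (f : ℕ → ℂ → ℂ) (t : ℕ → Lp ℂ 2 (arcLength Ω)),
    (∀ n, IsSmoothHolomorphic Ω (f n) ∧ t n =ᵐ[arcLength Ω] f n) ∧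
    Tendsto t atTop (𝓝 h) ∧ TendstoLocallyUniformlyOn f F atTop Ω

/-- `S` is (on `Ω × Ω`) the Szegő kernel of `Ω`, i.e. the reproducing kernel of `H²(bΩ)`.
Here `k ζ ∈ H²(bΩ)` is the boundary function of `S(·, ζ)`; for `z ∈ Ω` and `ζ ∈ bΩ` the value
`S(z, ζ)` is the conjugate of the boundary value of `S(·, z)` at `ζ`. -/
def IsSzegoKernel (Ω : Set ℂ) (S : ℂ → ℂ → ℂ) : Prop :=
  ∃ k : ℂ → Lp ℂ 2 (arcLength Ω),
    (∀ ζ ∈ Ω, k ζ ∈ hardySpace Ω ∧ IsHolomorphicExtension Ω (k ζ) (fun z => S z ζ)) ∧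
    (∀ z ∈ Ω, ∀ ζ ∈ Ω, S z ζ = starRingEnd ℂ (S ζ z)) ∧
    (∀ h ∈ hardySpace Ω, ∀ F : ℂ → ℂ, IsHolomorphicExtension Ω h F → ∀ z ∈ Ω,
      F z = ∫ ζ, starRingEnd ℂ (k z ζ) * h ζ ∂(arcLength Ω))

/-- The Szegő kernel is unique on `Ω × Ω`. -/
theorem IsSzegoKernel.unique {Ω : Set ℂ} {S T : ℂ → ℂ → ℂ} (hS : IsSzegoKernel Ω S)
    (hT : IsSzegoKernel Ω T) {z ζ : ℂ} (hz : z ∈ Ω) (hζ : ζ ∈ Ω) : S z ζ = T z ζ := by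
  obtain ⟨k, hk, hsymm, hrep⟩ := hS
  obtain ⟨l, hl, -, hrep'⟩ := hT
  have h1 : T z ζ = ∫ w, starRingEnd ℂ (k z w) * l ζ w ∂(arcLength Ω) :=
    hrep (l ζ) (hl ζ hζ).1 _ (hl ζ hζ).2 z hz
  have h2 : S ζ z = ∫ w, starRingEnd ℂ (l ζ w) * k z w ∂(arcLength Ω) :=
    hrep' (k z) (hk z hz).1 _ (hk z hz).2 ζ hζ
  rw [hsymm z hz ζ hζ, h2, h1, ← integral_conj]
  congr 1
  ext w
  simp [mul_comm]

open Classical in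
/-- The Szegő kernel `S_Ω(z, ζ)` of `Ω`. -/
def szegoKernel (Ω : Set ℂ) : ℂ → ℂ → ℂ :=
  if h : ∃ S, IsSzegoKernel Ω S then h.choose else 0

/-- The Szegő kernel on the diagonal, `S_Ω(z) = S_Ω(z, z)`, a real number. -/
def szegoDiag (Ω : Set ℂ) (z : ℂ) : ℝ := (szegoKernel Ω z z).re

/-- The density `s_Ω = √(∂²(log S_Ω) / ∂z ∂z̄)` of the Szegő metric `s_Ω(z) |dz|`, where
`∂² / ∂z ∂z̄ = Δ / 4`. -/
def szegoMetric (Ω : Set ℂ) (z : ℂ) : ℝ :=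
  √(Laplacian.laplacian (fun w : ℂ => Real.log (szegoDiag Ω w)) z / 4)

/-- `m(z) |dz|` is a `C²`-smooth conformal metric on `Ω`. -/
def IsConformalMetric (Ω : Set ℂ) (m : ℂ → ℝ) : Prop :=
  (∀ z ∈ Ω, 0 < m z) ∧ ContDiffOn ℝ 2 m Ω

/-- The Gaussian curvature `κ_m = - Δ(log m) / m²` of the conformal metric `m(z) |dz|`. -/
def gaussianCurvature (m : ℂ → ℝ) (z : ℂ) : ℝ :=
  -(Laplacian.laplacian (fun w : ℂ => Real.log (m w)) z) / m z ^ 2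

end SzegoMetric

end

namespace SzegoMetric

open Metric Complex
open scoped Pointwise

/-! ### Circles and annuli -/

/-! On an annulus the monomials `z ^ n` are orthogonal in `L²` of the boundary, and the two circles
together give `z ^ n` the squared norm `unitLength * (1 + r ^ (2 * n + 1))`. Hence the Szegő kernel
is an explicit Laurent series (`isSzegoKernel_laurentKernel`). Write `r = e^{-L}`, `s = log |z|² + L
∈ (-L, L)`, and `E(s) = ∑ e^{s(n+1/2)} / (2 cosh (L(n+1/2)))`. The diagonal of the kernel is `E(s)`
times a constant times `1 / |z|` (`szegoDiag_annulus_eq_expSum`). Since `log |z|²` is harmonic, only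
`Λ = log E` contributes to the metric: with `φ = Λ''`, the squared density is `φ(s) / |z|²`, and the
curvature is `-2 (log φ)''(s) / φ(s)` (`gaussianCurvature_szegoMetric_annulus`). `E` is the moment
generating function of a measure on the half-integers, so it is analytic on `(-L, L)` and `φ` is a
variance, hence positive. The involution `n ↦ -1 - n` makes everything even in `s`.

It remains to see that `(log φ)''` takes both signs. If it were `≤ 0` throughout, `φ` would be
largest at `0`, so `Λ` would be bounded on `(-L, L)`; but `E` blows up at `s = L`
(`exists_pos_iteratedDeriv_two_log`). If it were `≥ 0` throughout, `φ` would be smallest at `0`,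
where it is at least `1/4`, so `Λ` would grow at least quadratically. For `L = 10` this contradicts
the bound `E(8) ≤ 4` (`exists_neg_iteratedDeriv_two_log`). -/

/-- The parametrization of the circle of radius `ρ` by `ℝ / 2πℤ`. -/
noncomputable def circ (ρ : ℝ) (θ : AddCircle (2 * Real.pi)) : ℂ := ρ * (AddCircle.toCircle θ : ℂ)

instance : Fact (0 < 2 * Real.pi) := ⟨Real.two_pi_pos⟩

lemma continuous_circ (ρ : ℝ) : Continuous (circ ρ) := by
  unfold circ
  exact continuous_const.mul (continuous_subtype_val.comp AddCircle.continuous_toCircle)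

lemma norm_circ {ρ : ℝ} (hρ : 0 < ρ) (θ : AddCircle (2 * Real.pi)) : ‖circ ρ θ‖ = ρ := by
  rw [circ, norm_mul, Circle.norm_coe, mul_one, norm_real, Real.norm_of_nonneg hρ.le]

lemma circ_add (ρ : ℝ) (θ η : AddCircle (2 * Real.pi)) :
    circ ρ (θ + η) = (AddCircle.toCircle θ : ℂ) * circ ρ η := by
  simp [circ, AddCircle.toCircle_add]; ring

lemma circ_injective {ρ : ℝ} (hρ : 0 < ρ) : Function.Injective (circ ρ) := by
  intro a b h
  have : (ρ : ℂ) ≠ 0 := by exact_mod_cast hρ.ne'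
  exact AddCircle.injective_toCircle Real.two_pi_pos.ne' (Subtype.ext (mul_left_cancel₀ this h))

lemma circ_coe (ρ t : ℝ) : circ ρ (t : AddCircle (2 * Real.pi)) = circleMap 0 ρ t := by
  have : (2 * Real.pi) / (2 * Real.pi) = 1 := div_self Real.two_pi_pos.ne'
  simp [circ, circleMap, AddCircle.toCircle_apply_mk, Circle.coe_exp]

lemma exists_circ_eq {ρ : ℝ} {z : ℂ} (hz : ‖z‖ = ρ) : ∃ θ, circ ρ θ = z := by
  refine ⟨((arg z : ℝ) : AddCircle (2 * Real.pi)), ?_⟩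
  rw [circ_coe, circleMap, zero_add, ← hz, norm_mul_exp_arg_mul_I]

lemma range_circ {ρ : ℝ} (hρ : 0 < ρ) : range (circ ρ) = sphere 0 ρ := by
  ext z
  rw [mem_sphere_zero_iff_norm]
  exact ⟨by rintro ⟨θ, rfl⟩; exact norm_circ hρ θ, fun h => exists_circ_eq h⟩

lemma measurableEmbedding_circ {ρ : ℝ} (hρ : 0 < ρ) : MeasurableEmbedding (circ ρ) :=
  ((continuous_circ ρ).isClosedEmbedding (circ_injective hρ)).measurableEmbedding

lemma hausdorffMeasure_sphere_ne_top (ρ : ℝ) : μH[1] (sphere (0 : ℂ) ρ) ≠ ⊤ := by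
  rcases le_or_gt 0 ρ with h | h
  · rw [← abs_of_nonneg h, ← image_circleMap_Ioc 0 ρ]
    have := (lipschitzWith_circleMap 0 ρ).hausdorffMeasure_image_le zero_le_one (Ioc 0 (2 * Real.pi))
    refine ne_top_of_le_ne_top ?_ this
    rw [hausdorffMeasure_real]
    exact ENNReal.mul_ne_top (by simp) measure_Ioc_lt_top.ne
  · simp [sphere_eq_empty_of_neg h]

lemma hausdorffMeasure_sphere {ρ : ℝ} (hρ : 0 < ρ) :
    μH[1] (sphere (0 : ℂ) ρ) = ENNReal.ofReal ρ * μH[1] (sphere (0 : ℂ) 1) := by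
  have := Measure.hausdorffMeasure_smul₀ (𝕜 := ℝ) (d := 1) zero_le_one hρ.ne' (sphere (0 : ℂ) 1)
  rw [_root_.smul_sphere _ _ zero_le_one, smul_zero, mul_one, Real.norm_of_nonneg hρ.le, NNReal.rpow_one,
    ENNReal.smul_def, smul_eq_mul, ← enorm_eq_nnnorm, Real.enorm_of_nonneg hρ.le] at this
  exact this

/-- The real part is 1-Lipschitz and maps the circle onto `[-1, 1]`, which has positive length. -/
lemma hausdorffMeasure_unitSphere_ne_zero : μH[1] (sphere (0 : ℂ) 1) ≠ 0 := by
  intro h0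
  have hlip : LipschitzWith 1 (fun z : ℂ => z.re) := by
    refine LipschitzWith.of_dist_le_mul fun x y => ?_
    simpa [Real.dist_eq, Complex.dist_eq] using abs_re_le_norm (x - y)
  have h1 := hlip.hausdorffMeasure_image_le zero_le_one (sphere (0 : ℂ) 1)
  rw [h0, hausdorffMeasure_real, mul_zero, nonpos_iff_eq_zero] at h1
  have hsub : Icc (-1 : ℝ) 1 ⊆ (fun z : ℂ => z.re) '' sphere (0 : ℂ) 1 := by
    rintro x ⟨hx1, hx2⟩
    refine ⟨exp (Real.arccos x * I), by simp [norm_exp_ofReal_mul_I], ?_⟩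
    simp only [exp_ofReal_mul_I_re]
    exact Real.cos_arccos hx1 hx2
  have := measure_mono_null hsub h1
  norm_num at this

/-- The length of the unit circle, as measured by the one-dimensional Hausdorff measure. -/
noncomputable def unitLength : ℝ := (μH[1] (sphere (0 : ℂ) 1)).toReal

lemma unitLength_pos : 0 < unitLength :=
  ENNReal.toReal_pos hausdorffMeasure_unitSphere_ne_zero (hausdorffMeasure_sphere_ne_top 1)

/-- Pulled back to `ℝ / 2πℤ`, Hausdorff measure is finite and rotation invariant, so it is a
multiple of Haar measure. The value of `unitLength` is never needed: it only scales the kernel, and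
the metric depends on derivatives of its logarithm. -/
lemma restrict_sphere_eq {ρ : ℝ} (hρ : 0 < ρ) :
    (μH[1] : Measure ℂ).restrict (sphere 0 ρ) =
      ENNReal.ofReal (ρ * unitLength) • (AddCircle.haarAddCircle).map (circ ρ) := by
  have he := measurableEmbedding_circ hρ
  set ν : Measure (AddCircle (2 * Real.pi)) := (μH[1] : Measure ℂ).comap (circ ρ) with hν
  have huniv : ν univ = μH[1] (sphere (0 : ℂ) ρ) := by
    rw [hν, he.comap_apply, image_univ, range_circ hρ]
  have : IsFiniteMeasure ν := ⟨by
    rw [huniv]; exact (hausdorffMeasure_sphere_ne_top ρ).lt_top⟩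
  have : ν.IsAddLeftInvariant := by
    refine ⟨fun θ => ?_⟩
    ext s hs
    rw [Measure.map_apply (measurable_const_add θ) hs, hν, he.comap_apply, he.comap_apply]
    have h1 : circ ρ '' s = (AddCircle.toCircle θ : ℂ) • (circ ρ '' ((θ + ·) ⁻¹' s)) := by
      ext z
      rw [mem_smul_set]
      constructor
      · rintro ⟨η, hη, rfl⟩
        refine ⟨circ ρ (-θ + η), ⟨_, by simpa using hη, rfl⟩, ?_⟩
        rw [smul_eq_mul, ← circ_add, add_neg_cancel_left]
      · rintro ⟨_, ⟨η, hη, rfl⟩, rfl⟩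
        exact ⟨θ + η, hη, by rw [smul_eq_mul, ← circ_add]⟩
    rw [h1]
    rw [Measure.hausdorffMeasure_smul₀ zero_le_one (Circle.coe_ne_zero _), NNReal.rpow_one,
      ENNReal.smul_def, smul_eq_mul, ← enorm_eq_nnnorm, ← ofReal_norm, Circle.norm_coe,
      ENNReal.ofReal_one, one_mul]
  have h2 := Measure.isAddInvariant_eq_smul_of_compactSpace ν AddCircle.haarAddCircle
  set c := Measure.addHaarScalarFactor ν AddCircle.haarAddCircle
  have h3 : (c : ENNReal) = ENNReal.ofReal (ρ * unitLength) := by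
    have h4 : ν univ = c := by 
      conv_lhs => rw [h2]
      rw [Measure.smul_apply, measure_univ, ENNReal.smul_def, smul_eq_mul, mul_one]
    rw [← h4, huniv, hausdorffMeasure_sphere hρ, ENNReal.ofReal_mul hρ.le, unitLength,
      ENNReal.ofReal_toReal (hausdorffMeasure_sphere_ne_top 1)]
  rw [← h3, ← range_circ hρ, ← he.map_comap, ← hν]
  conv_lhs => rw [h2]
  rw [Measure.map_smul]
  rfl

/-! ### Topology and boundary of the annulus -/

lemma closure_annulus {r : ℝ} (h0 : 0 < r) (h1 : r < 1) :
    closure (annulus r) = {z | r ≤ ‖z‖ ∧ ‖z‖ ≤ 1} := by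
  apply subset_antisymm
  · refine closure_minimal (fun z hz => ⟨hz.1.le, hz.2.le⟩) ?_
    exact (isClosed_le continuous_const continuous_norm).inter
      (isClosed_le continuous_norm continuous_const)
  · rintro z ⟨hz1, hz2⟩
    have hz : z ≠ 0 := norm_pos_iff.1 (h0.trans_le hz1)
    have hcl : ‖z‖ ∈ closure (Ioo r 1) := by rw [closure_Ioo h1.ne]; exact ⟨hz1, hz2⟩
    have hcont : Continuous fun t : ℝ => (t : ℂ) * (z / ‖z‖) := by fun_prop
    have := image_closure_subset_closure_image hcont (s := Ioo r 1) (mem_image_of_mem _ hcl)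
    have hz' : (‖z‖ : ℂ) ≠ 0 := by simpa using hz
    simp only [mul_div_cancel₀ z hz'] at this
    refine closure_mono ?_ this
    rintro _ ⟨t, ⟨ht1, ht2⟩, rfl⟩
    have : ‖(t : ℂ) * (z / ‖z‖)‖ = t := by
      simp [norm_ne_zero_iff.2 hz, abs_of_pos (h0.trans ht1)]
    exact ⟨by rwa [this], by rwa [this]⟩

lemma isOpen_annulus (r : ℝ) : IsOpen (annulus r) :=
  (isOpen_lt continuous_const continuous_norm).inter (isOpen_lt continuous_norm continuous_const)

lemma frontier_annulus {r : ℝ} (h0 : 0 < r) (h1 : r < 1) :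
    frontier (annulus r) = sphere 0 1 ∪ sphere 0 r := by
  rw [frontier, closure_annulus h0 h1, (isOpen_annulus r).interior_eq]
  ext z
  simp only [annulus, Set.mem_sdiff, mem_ofPred_eq, mem_union, mem_sphere_zero_iff_norm, not_and, not_lt]
  constructor
  · rintro ⟨⟨ha, hb⟩, hc⟩
    rcases ha.lt_or_eq with h | h
    · exact Or.inl (le_antisymm hb (hc h))
    · exact Or.inr h.symm
  · rintro (h | h)
    · exact ⟨⟨by linarith, h.le⟩, fun _ => h.ge⟩
    · exact ⟨⟨h.ge, by linarith⟩, fun h' => by linarith⟩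

lemma arcLength_annulus {r : ℝ} (h0 : 0 < r) (h1 : r < 1) :
    arcLength (annulus r) =
      ENNReal.ofReal unitLength • (AddCircle.haarAddCircle).map (circ 1) +
      ENNReal.ofReal (r * unitLength) • (AddCircle.haarAddCircle).map (circ r) := by
  rw [arcLength, frontier_annulus h0 h1, Measure.restrict_union, restrict_sphere_eq one_pos,
    restrict_sphere_eq h0, one_mul]
  · rw [Set.disjoint_left]
    intro z hz hz'
    simp only [mem_sphere_zero_iff_norm] at hz hz'
    linarith
  · exact isClosed_sphere.measurableSet

lemma isConnected_annulus {r : ℝ} (h0 : 0 < r) (h1 : r < 1) : IsConnected (annulus r) := by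
  have hc : IsConnected (Ioo r 1 ×ˢ (univ : Set ℝ)) := (isConnected_Ioo h1).prod isConnected_univ
  have : annulus r = (fun p : ℝ × ℝ => (p.1 : ℂ) * exp (p.2 * I)) '' (Ioo r 1 ×ˢ univ) := by
    ext z
    constructor
    · intro hz
      exact ⟨(‖z‖, arg z), ⟨hz, mem_univ _⟩, norm_mul_exp_arg_mul_I z⟩
    · rintro ⟨⟨a, b⟩, ⟨⟨ha1, ha2⟩, -⟩, rfl⟩
      have : ‖(a : ℂ) * exp (b * I)‖ = a := by
        simp [norm_exp_ofReal_mul_I, abs_of_pos (h0.trans ha1)]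
      exact ⟨by rwa [this], by rwa [this]⟩
  rw [this]
  exact hc.image _ (by fun_prop)

lemma fderiv_norm_sq_ne_zero {z : ℂ} (hz : z ≠ 0) : fderiv ℝ (fun w : ℂ => ‖w‖ ^ 2) z ≠ 0 := by
  intro h
  have := congrArg (fun L => L z) h
  simp [fderiv_norm_sq_apply, hz] at this

lemma isSmoothlyBoundedDomain_annulus {r : ℝ} (h0 : 0 < r) (h1 : r < 1) :
    IsSmoothlyBoundedDomain (annulus r) where
  isOpen := isOpen_annulus r
  isConnected := isConnected_annulus h0 h1
  isBounded := isBounded_ball.subset (s := annulus r) (t := ball 0 1) fun z hz => by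
    simpa using hz.2
  smooth_boundary p hp := by
    have hsm : ContDiff ℝ ∞ fun z : ℂ => ‖z‖ ^ 2 := contDiff_norm_sq ℝ
    rw [frontier_annulus h0 h1] at hp
    rcases hp with hp | hp <;> rw [mem_sphere_zero_iff_norm] at hp
    · refine ⟨{z | r < ‖z‖}, isOpen_lt continuous_const continuous_norm, by simpa [hp] using h1,
        fun z => ‖z‖ ^ 2 - 1, (hsm.sub contDiff_const).contDiffOn, fun z hz => ?_, ?_⟩
      · rw [fderiv_sub_const]
        exact fderiv_norm_sq_ne_zero (norm_pos_iff.1 (h0.trans hz))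
      · ext z
        simp only [annulus, mem_inter_iff, mem_ofPred_eq]
        have : ‖z‖ < 1 ↔ ‖z‖ ^ 2 - 1 < 0 := by
          rw [sub_neg, sq_lt_one_iff₀ (norm_nonneg z)]
        tauto
    · refine ⟨{z | 0 < ‖z‖ ∧ ‖z‖ < 1}, isOpen_annulus 0, ⟨by rwa [hp], by rwa [hp]⟩,
        fun z => r ^ 2 - ‖z‖ ^ 2, (contDiff_const.sub hsm).contDiffOn, fun z hz => ?_, ?_⟩
      · rw [fderiv_const_sub, neg_ne_zero]
        exact fderiv_norm_sq_ne_zero (norm_pos_iff.1 hz.1)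
      · ext z
        simp only [annulus, mem_inter_iff, mem_ofPred_eq]
        have : r < ‖z‖ ↔ r ^ 2 - ‖z‖ ^ 2 < 0 := by
          rw [sub_neg, sq_lt_sq₀ h0.le (norm_nonneg z)]
        constructor
        · rintro ⟨⟨a, b⟩, c⟩; exact ⟨c, this.1 a⟩
        · rintro ⟨c, a⟩; exact ⟨⟨this.2 a, c.2⟩, c⟩

end SzegoMetric

namespace SzegoMetric

open Metric Complex

/-! ### Laurent coefficients -/

lemma fourier_eq_circ_zpow (n : ℤ) (θ : AddCircle (2 * Real.pi)) :
    fourier n θ = circ 1 θ ^ n := by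
  rw [fourier_apply, AddCircle.toCircle_zsmul]
  simp [circ]

lemma circ_zpow (ρ : ℝ) (n : ℤ) (θ : AddCircle (2 * Real.pi)) :
    circ ρ θ ^ n = (ρ : ℂ) ^ n * fourier n θ := by
  rw [fourier_eq_circ_zpow]
  simp [circ, mul_zpow]

/-- The first bound controls `n → +∞` with ratio `x < 1`, the second `n → -∞` with ratio `a / x <
1`. -/
lemma summable_of_two_geometric_bounds {E : Type*} [NormedAddCommGroup E] [CompleteSpace E]
    {a x C : ℝ} (ha : 0 < a) (hax : a < x) (hx : x < 1) {v : ℤ → E}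
    (h1 : ∀ n, ‖v n‖ ≤ C * x ^ n) (h2 : ∀ n, ‖v n‖ ≤ C * (x / a) ^ n) : Summable v := by
  refine Summable.of_nat_of_neg ?_ ?_
  · refine Summable.of_norm_bounded (g := fun n : ℕ => C * x ^ n)
      ((summable_geometric_of_lt_one (ha.trans hax).le hx).mul_left C) fun n => ?_
    simpa using h1 n
  · refine Summable.of_norm_bounded (g := fun n : ℕ => C * (a / x) ^ n)
      ((summable_geometric_of_lt_one (div_pos ha (ha.trans hax)).le
        ((div_lt_one (ha.trans hax)).2 hax)).mul_left C) fun n => ?_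
    have := h2 (-n)
    rwa [zpow_neg, zpow_natCast, ← inv_pow, inv_div] at this

lemma continuous_comp_circ {r ρ : ℝ} (h0 : 0 < r) (h1 : r < 1) (hr : r ≤ ρ) (hρ : ρ ≤ 1) {f : ℂ → ℂ}
    (hf : ContinuousOn f (closure (annulus r))) : Continuous (f ∘ circ ρ) := by
  refine hf.comp_continuous (continuous_circ ρ) fun θ => ?_
  rw [closure_annulus h0 h1]
  simpa [norm_circ (h0.trans_le hr)] using ⟨hr, hρ⟩

lemma norm_fourierCoeff_le (g : AddCircle (2 * Real.pi) → ℂ) (n : ℤ) :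
    ‖fourierCoeff g n‖ ≤ ∫ θ, ‖g θ‖ ∂AddCircle.haarAddCircle := by
  refine (norm_integral_le_integral_norm _).trans_eq ?_
  congr 1
  ext θ
  rw [norm_smul, fourier_apply, Circle.norm_coe, one_mul]

lemma circleIntegral_eq_fourierCoeff {ρ : ℝ} (hρ : 0 < ρ) (f : ℂ → ℂ) (n : ℤ) :
    (∮ z in C(0, ρ), (z - 0)⁻¹ • (z ^ (-n) * f z)) =
      2 * Real.pi * I * (ρ : ℂ) ^ (-n) * fourierCoeff (f ∘ circ ρ) n := by
  rw [fourierCoeff_eq_intervalIntegral _ n 0, circleIntegral, zero_add, one_div,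
    ← intervalIntegral.integral_smul, ← intervalIntegral.integral_const_mul]
  congr 1
  ext θ
  have hne : circleMap 0 ρ θ ≠ 0 := circleMap_ne_center hρ.ne'
  have hpi : (Real.pi : ℂ) ≠ 0 := by exact_mod_cast Real.pi_ne_zero
  have h1 : circleMap 0 ρ θ ^ (-n) = (ρ : ℂ) ^ (-n) * fourier (-n) (θ : AddCircle (2 * Real.pi)) := by
    rw [← circ_coe, circ_zpow]
  rw [deriv_circleMap, sub_zero, Function.comp_apply, circ_coe, h1]
  simp only [smul_eq_mul, real_smul]
  push_cast
  field_simp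

/-- The Laurent coefficients of a function on an annulus with outer radius `1`. -/
noncomputable def laurentCoeff (f : ℂ → ℂ) (n : ℤ) : ℂ := fourierCoeff (f ∘ circ 1) n

/-- By Cauchy's theorem the integral of `z ^ (-n - 1) * f z` over a circle does not depend on the
radius. Continuity on the closed annulus allows both boundary circles. -/
lemma fourierCoeff_comp_circ {r ρ : ℝ} (h0 : 0 < r) (h1 : r < 1) (hr : r ≤ ρ) (hρ : ρ ≤ 1)
    {f : ℂ → ℂ} (hd : DifferentiableOn ℂ f (annulus r))
    (hf : ContinuousOn f (closure (annulus r))) (n : ℤ) :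
    fourierCoeff (f ∘ circ ρ) n = (ρ : ℂ) ^ n * laurentCoeff f n := by
  have hρ0 : 0 < ρ := h0.trans_le hr
  have key : (∮ z in C(0, 1), (z - 0)⁻¹ • (z ^ (-n) * f z)) =
      ∮ z in C(0, ρ), (z - 0)⁻¹ • (z ^ (-n) * f z) := by
    refine circleIntegral_sub_center_inv_smul_eq_of_differentiable_on_annulus_off_countable hρ0 hρ
      countable_empty ?_ ?_
    · refine ContinuousOn.mul ?_ (hf.mono ?_)
      · intro z hz
        have : z ≠ 0 := by
          rintro rfl
          exact hz.2 (by simpa using hρ0)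
        exact (continuousAt_zpow₀ z _ (Or.inl this)).continuousWithinAt
      · rintro z ⟨hz1, hz2⟩
        rw [closure_annulus h0 h1]
        simp only [mem_closedBall, dist_zero_right, mem_ball, not_lt] at hz1 hz2
        exact ⟨hr.trans hz2, hz1⟩
    · rintro z ⟨⟨hz1, hz2⟩, -⟩
      simp only [mem_closedBall, dist_zero_right, mem_ball, not_le] at hz1 hz2
      have hz : z ≠ 0 := norm_pos_iff.1 (hρ0.trans hz2)
      exact (differentiableAt_zpow.2 (Or.inl hz)).mul
        (hd.differentiableAt ((isOpen_annulus r).mem_nhds ⟨hr.trans_lt hz2, hz1⟩))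
  rw [circleIntegral_eq_fourierCoeff one_pos, circleIntegral_eq_fourierCoeff hρ0] at key
  have hρ' : (ρ : ℂ) ^ n ≠ 0 := zpow_ne_zero _ (by exact_mod_cast hρ0.ne')
  have hpi : (2 * Real.pi * I : ℂ) ≠ 0 := two_pi_I_ne_zero
  rw [laurentCoeff]
  simp only [ofReal_one, one_zpow, mul_one, mul_assoc (2 * Real.pi * I : ℂ)] at key
  rw [mul_left_cancel₀ hpi key, ← mul_assoc, zpow_neg, mul_inv_cancel₀ hρ', one_mul]

/-- The Fourier series of `f` on the circle through `z` converges absolutely: the `L¹` norm of `f`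
on the outer circle bounds the coefficients as `n → +∞`, the one on the inner circle as `n → -∞`. -/
lemma hasSum_laurent {r : ℝ} (h0 : 0 < r) (h1 : r < 1)
    {f : ℂ → ℂ} (hd : DifferentiableOn ℂ f (annulus r))
    (hf : ContinuousOn f (closure (annulus r))) {z : ℂ} (hz : z ∈ annulus r) :
    HasSum (fun n : ℤ => laurentCoeff f n * z ^ n) (f z) := by
  obtain ⟨hz1, hz2⟩ := hz
  have hz0 : 0 < ‖z‖ := h0.trans hz1
  obtain ⟨θ, hθ⟩ := exists_circ_eq (ρ := ‖z‖) rfl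
  have hcoeff := fourierCoeff_comp_circ h0 h1 hz1.le hz2.le hd hf
  set C := max (∫ θ, ‖(f ∘ circ 1) θ‖ ∂AddCircle.haarAddCircle)
    (∫ θ, ‖(f ∘ circ r) θ‖ ∂AddCircle.haarAddCircle)
  have hsum : Summable (fourierCoeff (f ∘ circ ‖z‖)) := by
    refine summable_of_two_geometric_bounds (C := C) h0 hz1 hz2 (fun n => ?_) (fun n => ?_)
    · rw [hcoeff, norm_mul, norm_zpow, norm_real, norm_norm, mul_comm]
      gcongr
      exact (norm_fourierCoeff_le _ n).trans (le_max_left _ _)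
    · have hr := fourierCoeff_comp_circ h0 h1 le_rfl h1.le hd hf n
      have hrn : (0 : ℝ) < r ^ n := zpow_pos h0 n
      have h3 : r ^ n * ‖laurentCoeff f n‖ ≤ C := by
        have := (norm_fourierCoeff_le (f ∘ circ r) n).trans (le_max_right _ _ : _ ≤ C)
        rwa [hr, norm_mul, norm_zpow, norm_real, Real.norm_of_nonneg h0.le] at this
      rw [hcoeff, norm_mul, norm_zpow, norm_real, norm_norm, div_zpow]
      calc ‖z‖ ^ n * ‖laurentCoeff f n‖ = (r ^ n * ‖laurentCoeff f n‖) * (‖z‖ ^ n / r ^ n) := by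
            field_simp
        _ ≤ C * (‖z‖ ^ n / r ^ n) := by gcongr
  have hc : Continuous (f ∘ circ ‖z‖) := continuous_comp_circ h0 h1 hz1.le hz2.le hf
  have := has_pointwise_sum_fourier_series_of_summable
    (f := (⟨f ∘ circ ‖z‖, hc⟩ : C(AddCircle (2 * Real.pi), ℂ))) hsum θ
  simp only [ContinuousMap.coe_mk, Function.comp_apply, hθ] at this
  convert this using 1
  ext n
  have h4 := circ_zpow ‖z‖ n θ
  rw [hθ] at h4
  change _ = fourierCoeff (f ∘ circ ‖z‖) n • fourier n θ
  rw [hcoeff, h4, smul_eq_mul]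
  ring

lemma integral_arcLength_annulus {r : ℝ} (h0 : 0 < r) (h1 : r < 1) {g : ℂ → ℂ}
    (hg : ContinuousOn g (closure (annulus r))) :
    ∫ z, g z ∂(arcLength (annulus r)) =
      unitLength * (∫ θ, g (circ 1 θ) ∂AddCircle.haarAddCircle) +
      r * unitLength * ∫ θ, g (circ r θ) ∂AddCircle.haarAddCircle := by
  have hint : ∀ ρ, r ≤ ρ → ρ ≤ 1 → Integrable g ((AddCircle.haarAddCircle).map (circ ρ)) := by
    intro ρ hr hρ
    rw [(measurableEmbedding_circ (h0.trans_le hr)).integrable_map_iff]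
    exact (continuous_comp_circ h0 h1 hr hρ hg).integrable_of_hasCompactSupport
      (HasCompactSupport.of_compactSpace _)
  rw [arcLength_annulus h0 h1, integral_add_measure
      ((hint 1 h1.le le_rfl).smul_measure ENNReal.ofReal_ne_top)
      ((hint r le_rfl h1.le).smul_measure ENNReal.ofReal_ne_top),
    integral_smul_measure, integral_smul_measure,
    (measurableEmbedding_circ one_pos).integral_map, (measurableEmbedding_circ h0).integral_map,
    ENNReal.toReal_ofReal unitLength_pos.le,
    ENNReal.toReal_ofReal (mul_nonneg h0.le unitLength_pos.le), real_smul, real_smul]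
  push_cast
  rfl

lemma continuousOn_zpow_closure_annulus {r : ℝ} (h0 : 0 < r) (h1 : r < 1) (n : ℤ) :
    ContinuousOn (fun z : ℂ => z ^ n) (closure (annulus r)) := by
  intro z hz
  rw [closure_annulus h0 h1] at hz
  exact (continuousAt_zpow₀ z _ (Or.inl (norm_pos_iff.1 (h0.trans_le hz.1)))).continuousWithinAt

/-- The square of the norm of `z ^ n` in the Hardy space of the annulus. -/
noncomputable def normSqZpow (r : ℝ) (n : ℤ) : ℝ := unitLength * (1 + r ^ (2 * n + 1))

lemma normSqZpow_pos {r : ℝ} (h0 : 0 < r) (n : ℤ) : 0 < normSqZpow r n :=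
  mul_pos unitLength_pos (by positivity)

/-- The outer circle contributes the Laurent coefficient once; the inner circle contributes it with
the factor `r * r ^ n * r ^ n`, from arc length, the conjugate monomial and the Fourier coefficient.
-/
lemma integral_mul_conj_zpow {r : ℝ} (h0 : 0 < r) (h1 : r < 1)
    {f : ℂ → ℂ} (hd : DifferentiableOn ℂ f (annulus r))
    (hf : ContinuousOn f (closure (annulus r))) (n : ℤ) :
    ∫ z, f z * starRingEnd ℂ (z ^ n) ∂(arcLength (annulus r)) =
      normSqZpow r n * laurentCoeff f n := by
  have hstar : Continuous (starRingEnd ℂ) := continuous_conj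
  rw [integral_arcLength_annulus h0 h1 (g := fun z => f z * starRingEnd ℂ (z ^ n))
    (hf.mul (hstar.comp_continuousOn (continuousOn_zpow_closure_annulus h0 h1 n)))]
  have key : ∀ ρ : ℝ, ∫ θ, f (circ ρ θ) * starRingEnd ℂ (circ ρ θ ^ n) ∂AddCircle.haarAddCircle =
      (ρ : ℂ) ^ n * fourierCoeff (f ∘ circ ρ) n := by
    intro ρ
    rw [fourierCoeff, ← integral_const_mul]
    congr 1
    ext θ
    rw [circ_zpow, map_mul, ← fourier_neg, map_zpow₀, conj_ofReal, smul_eq_mul,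
      Function.comp_apply]
    ring
  have hr : (r : ℂ) ≠ 0 := by exact_mod_cast h0.ne'
  rw [key, key, fourierCoeff_comp_circ h0 h1 h1.le le_rfl hd hf,
    fourierCoeff_comp_circ h0 h1 le_rfl h1.le hd hf, normSqZpow]
  push_cast
  rw [zpow_add₀ hr, two_mul, zpow_add₀ hr, zpow_one, one_zpow]
  ring

end SzegoMetric

namespace SzegoMetric

open Metric Complex

/-! ### The Szegő kernel of an annulus -/

lemma isSmoothHolomorphic_zpow {r : ℝ} (h0 : 0 < r) (h1 : r < 1) (n : ℤ) :
    IsSmoothHolomorphic (annulus r) (fun z => z ^ n) := by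
  have hne : ∀ z ∈ closure (annulus r), z ≠ 0 := by
    intro z hz
    rw [closure_annulus h0 h1] at hz
    exact norm_pos_iff.1 (h0.trans_le hz.1)
  refine ⟨fun z hz => ?_, fun z hz => ?_⟩
  · exact (differentiableAt_zpow.2 (Or.inl (hne z (subset_closure hz)))).differentiableWithinAt
  · have hz0 := hne z hz
    have han : AnalyticAt ℂ (fun z : ℂ => z ^ n) z := analyticAt_id.fun_zpow hz0
    exact (han.contDiffAt.restrict_scalars ℝ).contDiffWithinAt

instance isFiniteMeasure_arcLength_annulus (r : ℝ) [h0 : Fact (0 < r)] [h1 : Fact (r < 1)] :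
    IsFiniteMeasure (arcLength (annulus r)) := by
  rw [arcLength_annulus h0.out h1.out]
  refine ⟨?_⟩
  simp [Measure.map_apply (continuous_circ _).measurable]

lemma memLp_zpow (r : ℝ) [h0 : Fact (0 < r)] [h1 : Fact (r < 1)] (n : ℤ) :
    MemLp (fun z : ℂ => z ^ n) 2 (arcLength (annulus r)) ∧
      ∀ᵐ z ∂(arcLength (annulus r)), ‖z ^ n‖ ≤ 1 + r ^ n := by
  have hm : MeasurableSet (frontier (annulus r)) := isClosed_frontier.measurableSet
  have hb : ∀ᵐ z ∂(arcLength (annulus r)), ‖z ^ n‖ ≤ 1 + r ^ n := by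
    refine (ae_restrict_mem hm).mono fun z hz => ?_
    have hrn : 0 < r ^ n := zpow_pos h0.out n
    rw [frontier_annulus h0.out h1.out] at hz
    rw [norm_zpow]
    rcases hz with hz | hz <;> rw [mem_sphere_zero_iff_norm] at hz <;> rw [hz]
    · rw [one_zpow]; linarith
    · linarith
  refine ⟨MemLp.of_bound ?_ _ hb, hb⟩
  exact ((continuousOn_zpow_closure_annulus h0.out h1.out n).mono
    frontier_subset_closure).aestronglyMeasurable hm

/-- The monomial `z ^ n` as an element of `L²` of the boundary of the annulus. -/
noncomputable def monomialLp (r : ℝ) [Fact (0 < r)] [Fact (r < 1)] (n : ℤ) :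
    Lp ℂ 2 (arcLength (annulus r)) := (memLp_zpow r n).1.toLp

lemma coeFn_monomialLp (r : ℝ) [Fact (0 < r)] [Fact (r < 1)] (n : ℤ) :
    monomialLp r n =ᵐ[arcLength (annulus r)] fun z => z ^ n := MemLp.coeFn_toLp _

lemma exists_norm_monomialLp_le (r : ℝ) [Fact (0 < r)] [Fact (r < 1)] :
    ∃ C : ℝ, ∀ n, ‖monomialLp r n‖ ≤ C * (1 + r ^ n) := by
  refine ⟨_, fun n => Lp.norm_le_of_ae_bound ?_ ?_⟩
  · have : 0 < r ^ n := zpow_pos Fact.out n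
    positivity
  · filter_upwards [coeFn_monomialLp r n, (memLp_zpow r n).2] with z hz hz'
    rwa [hz]

lemma inner_monomialLp {r : ℝ} [h0 : Fact (0 < r)] [h1 : Fact (r < 1)] {f : ℂ → ℂ}
    (hf : IsSmoothHolomorphic (annulus r) f) {t : Lp ℂ 2 (arcLength (annulus r))}
    (ht : t =ᵐ[arcLength (annulus r)] f) (n : ℤ) :
    inner ℂ (monomialLp r n) t = normSqZpow r n * laurentCoeff f n := by
  rw [← integral_mul_conj_zpow h0.out h1.out hf.1 hf.2.continuousOn, L2.inner_def]
  refine integral_congr_ae ?_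
  filter_upwards [coeFn_monomialLp r n, ht] with z hz hz'
  rw [hz, hz', RCLike.inner_apply]

/-- The coefficients of the kernel function `S(·, ζ)` with respect to the monomials. -/
noncomputable def kernelCoeff (r : ℝ) (ζ : ℂ) (n : ℤ) : ℂ := starRingEnd ℂ ζ ^ n / normSqZpow r n

lemma norm_kernelCoeff {r : ℝ} (h0 : 0 < r) (ζ : ℂ) (n : ℤ) :
    ‖kernelCoeff r ζ n‖ = ‖ζ‖ ^ n / normSqZpow r n := by
  rw [kernelCoeff, norm_div, norm_zpow, RCLike.norm_conj, norm_real,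
    Real.norm_of_nonneg (normSqZpow_pos h0 n).le]

/-- The factor `1 + r ^ n` dominates `|z ^ n|` on the annulus and its boundary, so this one estimate
gives both convergence in `L²` and uniform convergence inside. -/
lemma summable_norm_kernelCoeff {r : ℝ} (h0 : 0 < r) {ζ : ℂ} (hζ : ζ ∈ annulus r) :
    Summable fun n => ‖kernelCoeff r ζ n‖ * (1 + r ^ n) := by
  have h1 : r < 1 := hζ.1.trans hζ.2
  have hU := unitLength_pos
  have hpos : ∀ n : ℤ, 0 < r ^ n := fun n => zpow_pos h0 n
  have hodd : ∀ n : ℤ, r ^ (2 * n + 1) = r * (r ^ n * r ^ n) := fun n => by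
    rw [zpow_add₀ h0.ne', two_mul, zpow_add₀ h0.ne', zpow_one]; ring
  have hz : ∀ n : ℤ, 0 ≤ ‖ζ‖ ^ n := fun n => zpow_nonneg (norm_nonneg ζ) n
  -- With `q = r ^ n`, the ratios `(1 + q) / (1 + r q²)` and `(1 + q) q / (1 + r q²)` must be
  -- bounded. The dichotomy is `q ≤ 1` or `r q ≥ 1`, and integrality of `n` leaves no gap between.
  have hdich : ∀ n : ℤ, r ^ n ≤ 1 ∨ 1 ≤ r * r ^ n := by
    intro n
    rcases le_or_gt 0 n with h | h
    · exact Or.inl (zpow_le_one₀ h0 h1.le h)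
    · right
      have : r * r ^ n = r ^ (n + 1) := by rw [zpow_add₀ h0.ne', zpow_one, mul_comm]
      rw [this]
      exact one_le_zpow_of_nonpos₀ h0 h1.le (by omega)
  have hterm : ∀ n : ℤ, ‖‖kernelCoeff r ζ n‖ * (1 + r ^ n)‖ =
      ‖ζ‖ ^ n * ((1 + r ^ n) / normSqZpow r n) := by
    intro n
    rw [norm_mul, norm_norm, norm_kernelCoeff h0, Real.norm_of_nonneg (by linarith [hpos n])]
    ring
  refine summable_of_two_geometric_bounds (C := 2 / (r * unitLength)) h0 hζ.1 hζ.2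
    (fun n => ?_) (fun n => ?_)
  · rw [hterm, mul_comm]
    refine mul_le_mul_of_nonneg_right ?_ (hz n)
    rw [div_le_div_iff₀ (normSqZpow_pos h0 n) (by positivity), normSqZpow, hodd]
    have hq := hpos n
    have : (1 + r ^ n) * r ≤ 2 * (1 + r * (r ^ n * r ^ n)) := by
      rcases hdich n with h | h <;> nlinarith [mul_pos h0 (mul_pos hq hq)]
    nlinarith
  · rw [hterm, div_zpow, mul_comm, div_eq_mul_inv (‖ζ‖ ^ n), mul_comm (‖ζ‖ ^ n), ← mul_assoc]
    refine mul_le_mul_of_nonneg_right ?_ (hz n)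
    rw [← div_eq_mul_inv, div_div, div_le_div_iff₀ (normSqZpow_pos h0 n)
      (mul_pos (by positivity) (hpos n)), normSqZpow, hodd]
    have hq := hpos n
    have : (1 + r ^ n) * (r * r ^ n) ≤ 2 * (1 + r * (r ^ n * r ^ n)) := by
      rcases hdich n with h | h <;> nlinarith [mul_pos h0 (mul_pos hq hq), mul_pos h0 hq]
    nlinarith

lemma norm_zpow_le_of_mem_annulus {r : ℝ} (h0 : 0 < r) {z : ℂ} (hz : z ∈ annulus r) (n : ℤ) :
    ‖z‖ ^ n ≤ 1 + r ^ n := by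
  have hz0 : 0 < ‖z‖ := h0.trans hz.1
  have hrn : 0 < r ^ n := zpow_pos h0 n
  obtain ⟨m, rfl | rfl⟩ := n.eq_nat_or_neg
  · rw [zpow_natCast]
    linarith [pow_le_one₀ (n := m) hz0.le hz.2.le]
  · have : ‖z‖ ^ (-(m : ℤ)) ≤ r ^ (-(m : ℤ)) := by
      simp only [zpow_neg, zpow_natCast]
      gcongr
      exact hz.1.le
    linarith

/-- The boundary function of `S(·, ζ)`. -/
noncomputable def kernelLp (r : ℝ) [Fact (0 < r)] [Fact (r < 1)] (ζ : ℂ) :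
    Lp ℂ 2 (arcLength (annulus r)) := ∑' n, kernelCoeff r ζ n • monomialLp r n

/-- The Laurent series of the Szegő kernel of the annulus. -/
noncomputable def laurentKernel (r : ℝ) (z ζ : ℂ) : ℂ := ∑' n, kernelCoeff r ζ n * z ^ n

lemma hasSum_kernelLp {r : ℝ} [h0 : Fact (0 < r)] [Fact (r < 1)] {ζ : ℂ} (hζ : ζ ∈ annulus r) :
    HasSum (fun n => kernelCoeff r ζ n • monomialLp r n) (kernelLp r ζ) := by
  obtain ⟨C, hC⟩ := exists_norm_monomialLp_le r
  refine Summable.hasSum (Summable.of_norm_bounded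
    ((summable_norm_kernelCoeff h0.out hζ).mul_left C) fun n => ?_)
  rw [norm_smul, mul_left_comm]
  gcongr
  exact hC n

lemma tendsto_Icc_neg_atTop : Tendsto (fun N : ℕ => Finset.Icc (-(N : ℤ)) N) atTop atTop := by
  refine tendsto_atTop_finset_of_monotone (fun a b h => ?_) fun n => ⟨n.natAbs, ?_⟩
  · exact Finset.Icc_subset_Icc (by omega) (by omega)
  · rw [Finset.mem_Icc]; omega

lemma isSmoothHolomorphic_sum {r : ℝ} (h0 : 0 < r) (h1 : r < 1) (s : Finset ℤ) (c : ℤ → ℂ) :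
    IsSmoothHolomorphic (annulus r) (fun z => ∑ n ∈ s, c n * z ^ n) := by
  refine ⟨DifferentiableOn.fun_sum fun n _ => ?_, ContDiffOn.sum fun n _ => ?_⟩
  · exact (isSmoothHolomorphic_zpow h0 h1 n).1.const_mul _
  · exact contDiffOn_const.mul (isSmoothHolomorphic_zpow h0 h1 n).2

lemma coeFn_sum_monomialLp {r : ℝ} [Fact (0 < r)] [Fact (r < 1)] (s : Finset ℤ) (c : ℤ → ℂ) :
    (∑ n ∈ s, c n • monomialLp r n : Lp ℂ 2 (arcLength (annulus r)))
      =ᵐ[arcLength (annulus r)] fun z => ∑ n ∈ s, c n * z ^ n := by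
  have h1 : ∀ᵐ z ∂(arcLength (annulus r)), ∀ n ∈ s, (c n • monomialLp r n) z = c n * z ^ n := by
    rw [Finset.eventually_all]
    intro n _
    filter_upwards [coeFn_monomialLp r n, Lp.coeFn_smul (c n) (monomialLp r n)] with z hz hz'
    rw [hz', Pi.smul_apply, hz, smul_eq_mul]
  filter_upwards [h1, Lp.coeFn_finsetSum s fun n => c n • monomialLp r n] with z hz hz'
  rw [hz', Finset.sum_apply]
  exact Finset.sum_congr rfl hz

lemma isHolomorphicExtension_kernelLp {r : ℝ} [h0 : Fact (0 < r)] [h1 : Fact (r < 1)] {ζ : ℂ}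
    (hζ : ζ ∈ annulus r) :
    IsHolomorphicExtension (annulus r) (kernelLp r ζ) (fun z => laurentKernel r z ζ) := by
  refine ⟨fun N z => ∑ n ∈ Finset.Icc (-(N : ℤ)) N, kernelCoeff r ζ n * z ^ n,
    fun N => ∑ n ∈ Finset.Icc (-(N : ℤ)) N, kernelCoeff r ζ n • monomialLp r n,
    fun N => ⟨isSmoothHolomorphic_sum h0.out h1.out _ _, coeFn_sum_monomialLp _ _⟩,
    (hasSum_kernelLp hζ).comp tendsto_Icc_neg_atTop, ?_⟩
  have := tendstoUniformlyOn_tsum (f := fun n z => kernelCoeff r ζ n * z ^ n) (s := annulus r)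
    (summable_norm_kernelCoeff h0.out hζ) fun n z hz => by
      rw [norm_mul, norm_zpow]
      gcongr
      exact norm_zpow_le_of_mem_annulus h0.out hz n
  refine TendstoUniformlyOn.tendstoLocallyUniformlyOn fun u hu => ?_
  exact tendsto_Icc_neg_atTop.eventually (this u hu)

lemma laurentKernel_symm (r : ℝ) (z ζ : ℂ) :
    laurentKernel r z ζ = starRingEnd ℂ (laurentKernel r ζ z) := by
  rw [laurentKernel, laurentKernel, conj_tsum]
  congr 1
  ext n
  simp only [kernelCoeff, map_mul, map_div₀, map_zpow₀, conj_conj, conj_ofReal]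
  ring

/-- Pairing the kernel series with `f` term by term reproduces the Laurent series of `f` at `z`: the
weights in `kernelCoeff` cancel the squared norms. -/
lemma inner_kernelLp {r : ℝ} [h0 : Fact (0 < r)] [h1 : Fact (r < 1)] {f : ℂ → ℂ}
    (hf : IsSmoothHolomorphic (annulus r) f) {t : Lp ℂ 2 (arcLength (annulus r))}
    (ht : t =ᵐ[arcLength (annulus r)] f) {z : ℂ} (hz : z ∈ annulus r) :
    inner ℂ (kernelLp r z) t = f z := by
  have hs := (hasSum_conj'.2 ((hasSum_kernelLp hz).mapL (innerSL ℂ t)))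
  simp only [innerSL_apply_apply, inner_conj_symm, inner_smul_left] at hs
  refine hs.unique ?_
  convert! hasSum_laurent h0.out h1.out hf.1 hf.2.continuousOn hz using 2 with n
  have hne : (normSqZpow r n : ℂ) ≠ 0 := by exact_mod_cast (normSqZpow_pos h0.out n).ne'
  rw [inner_monomialLp hf ht, kernelCoeff, map_div₀, map_zpow₀, conj_conj, conj_ofReal]
  field_simp

theorem isSzegoKernel_laurentKernel {r : ℝ} (h0 : 0 < r) (h1 : r < 1) :
    IsSzegoKernel (annulus r) (laurentKernel r) := by
  have : Fact (0 < r) := ⟨h0⟩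
  have : Fact (r < 1) := ⟨h1⟩
  refine ⟨kernelLp r, fun ζ hζ => ⟨?_, isHolomorphicExtension_kernelLp hζ⟩,
    fun z _ ζ _ => laurentKernel_symm r z ζ, ?_⟩
  · obtain ⟨f, t, hft, ht, -⟩ := isHolomorphicExtension_kernelLp hζ
    exact mem_closure_of_tendsto ht (Eventually.of_forall fun n => ⟨f n, hft n⟩)
  -- The reproducing identity, known for smooth traces, passes to the limit: the left side converges
  -- pointwise, the right side by continuity of the inner product.
  · rintro h - F ⟨f, t, hft, ht, hfF⟩ z hz
    have h2 : Tendsto (fun n => f n z) atTop (𝓝 (F z)) := hfF.tendsto_at hz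
    have h3 : Tendsto (fun n => inner ℂ (kernelLp r z) (t n)) atTop
        (𝓝 (inner ℂ (kernelLp r z) h)) := tendsto_const_nhds.inner ht
    simp only [fun n => inner_kernelLp (hft n).1 (hft n).2 hz] at h3
    rw [tendsto_nhds_unique h2 h3, L2.inner_def]
    congr 1
    ext w
    rw [RCLike.inner_apply, mul_comm]

lemma isSzegoKernel_szegoKernel {r : ℝ} (h0 : 0 < r) (h1 : r < 1) :
    IsSzegoKernel (annulus r) (szegoKernel (annulus r)) := by
  have h : ∃ S, IsSzegoKernel (annulus r) S := ⟨_, isSzegoKernel_laurentKernel h0 h1⟩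
  rw [szegoKernel, dif_pos h]
  exact h.choose_spec

lemma szegoDiag_annulus {r : ℝ} (h0 : 0 < r) {z : ℂ} (hz : z ∈ annulus r) :
    szegoDiag (annulus r) z = ∑' n : ℤ, (‖z‖ ^ 2) ^ n / normSqZpow r n := by
  have h1 : r < 1 := hz.1.trans hz.2
  rw [szegoDiag, (isSzegoKernel_szegoKernel h0 h1).unique (isSzegoKernel_laurentKernel h0 h1) hz hz,
    laurentKernel]
  have : ∀ n : ℤ, kernelCoeff r z n * z ^ n = (((‖z‖ ^ 2) ^ n / normSqZpow r n : ℝ) : ℂ) := by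
    intro n
    rw [kernelCoeff, div_mul_eq_mul_div, ← mul_zpow, conj_mul']
    push_cast
    rfl
  simp only [this]
  rw [← ofReal_tsum, ofReal_re]

end SzegoMetric

namespace SzegoMetric

/-! ### The Laplacian of a radial function -/

lemma fderiv_fderiv_apply_eq {E : Type*} [NormedAddCommGroup E] [NormedSpace ℝ E] {f : E → ℝ}
    {z v : E} (hf : ContDiffAt ℝ 2 f z) {g' : ℝ → ℝ} {D : ℝ}
    (h1 : ∀ᶠ s in 𝓝 (0 : ℝ), HasDerivAt (fun s : ℝ => f (z + s • v)) (g' s) s)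
    (h2 : HasDerivAt g' D 0) : fderiv ℝ (fderiv ℝ f) z v v = D := by
  have hline : ∀ s : ℝ, HasDerivAt (fun s : ℝ => z + s • v) v s := fun s => by
    simpa using ((hasDerivAt_id s).smul_const v).const_add z
  have hcont : Tendsto (fun s : ℝ => z + s • v) (𝓝 0) (𝓝 z) := by
    have := (hline 0).continuousAt.tendsto
    rwa [zero_smul, add_zero] at this
  have hd : ∀ᶠ w in 𝓝 z, DifferentiableAt ℝ f w :=
    (hf.eventually (by simp)).mono fun w hw => hw.differentiableAt (by simp)
  have h3 : (fun s : ℝ => fderiv ℝ f (z + s • v) v) =ᶠ[𝓝 0] g' := by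
    filter_upwards [h1, hcont.eventually hd] with s hs hs'
    exact (hs'.hasFDerivAt.comp_hasDerivAt s (hline s)).unique hs
  have h4 : DifferentiableAt ℝ (fderiv ℝ f) (z + (0 : ℝ) • v) := by
    rw [zero_smul, add_zero]
    exact (hf.fderiv_right (m := 1) (by norm_num)).differentiableAt (by simp)
  have h5 : HasDerivAt (fun s : ℝ => fderiv ℝ f (z + s • v))
      (fderiv ℝ (fderiv ℝ f) (z + (0 : ℝ) • v) v) 0 :=
    h4.hasFDerivAt.comp_hasDerivAt (0 : ℝ) (hline 0)
  have h5' : HasDerivAt (fun s : ℝ => fderiv ℝ f (z + s • v) v)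
      (fderiv ℝ (fderiv ℝ f) (z + (0 : ℝ) • v) v v) 0 :=
    (ContinuousLinearMap.apply ℝ ℝ v).hasFDerivAt.comp_hasDerivAt (0 : ℝ) h5
  have h6 := (h5'.congr_of_eventuallyEq h3.symm).unique h2
  rwa [zero_smul, add_zero] at h6

/-- The terms with `F'` cancel between the two directions because `log |z|²` is harmonic; what
remains is `F''` times the squared gradient `4 / |z|²`. -/
lemma laplacian_comp_log_norm_sq {F : ℝ → ℝ} {z : ℂ} (hz : z ≠ 0)
    (hF : ContDiffAt ℝ 2 F (Real.log (‖z‖ ^ 2))) :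
    Laplacian.laplacian (fun w : ℂ => F (Real.log (‖w‖ ^ 2))) z =
      4 * iteratedDeriv 2 F (Real.log (‖z‖ ^ 2)) / ‖z‖ ^ 2 := by
  have hq0 : ‖z‖ ^ 2 ≠ 0 := by positivity
  have hf : ContDiffAt ℝ 2 (fun w : ℂ => F (Real.log (‖w‖ ^ 2))) z :=
    hF.comp z (((contDiff_norm_sq ℝ).contDiffAt).log hq0)
  set q := ‖z‖ ^ 2 with hq
  -- Along a unit direction `v`, `|z + s v|² = q + 2 b s + s²` with `b` the real inner product of
  -- `z` and `v`, so the Hessian entry is a one-variable second derivative.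
  have main : ∀ v : ℂ, ‖v‖ = 1 → ∀ b : ℝ, b = z.re * v.re + z.im * v.im →
      fderiv ℝ (fderiv ℝ (fun w : ℂ => F (Real.log (‖w‖ ^ 2)))) z v v =
        iteratedDeriv 2 F (Real.log q) * (2 * b / q) * (2 * b / q) +
          deriv F (Real.log q) * ((2 * q - 2 * b * (2 * b)) / q ^ 2) := by
    intro v hv b hb
    have hqs : ∀ s : ℝ, ‖z + s • v‖ ^ 2 = q + 2 * b * s + s ^ 2 := by
      intro s
      have hv' : v.re * v.re + v.im * v.im = 1 := by
        rw [← Complex.normSq_apply, Complex.normSq_eq_norm_sq, hv, one_pow]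
      rw [hq, ← Complex.normSq_eq_norm_sq, ← Complex.normSq_eq_norm_sq, Complex.normSq_apply,
        Complex.normSq_apply, hb]
      simp only [Complex.add_re, Complex.add_im, Complex.smul_re, Complex.smul_im, smul_eq_mul]
      linear_combination s ^ 2 * hv'
    have hqd : ∀ s : ℝ, HasDerivAt (fun s : ℝ => q + 2 * b * s + s ^ 2) (2 * b + 2 * s) s := by
      intro s
      have := (((hasDerivAt_id s).const_mul (2 * b)).const_add q).add (hasDerivAt_pow 2 s)
      convert! this using 1
      simp
    have hqc : Tendsto (fun s : ℝ => q + 2 * b * s + s ^ 2) (𝓝 0) (𝓝 q) := by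
      simpa using (hqd 0).continuousAt.tendsto
    have hlogc : Tendsto (fun s : ℝ => Real.log (q + 2 * b * s + s ^ 2)) (𝓝 0) (𝓝 (Real.log q)) :=
      (Real.continuousAt_log hq0).tendsto.comp hqc
    have hFd : ∀ᶠ y in 𝓝 (Real.log q), DifferentiableAt ℝ F y :=
      (hF.eventually (by simp)).mono fun y hy => hy.differentiableAt (by simp)
    refine fderiv_fderiv_apply_eq hf (g' := fun s => deriv F (Real.log (q + 2 * b * s + s ^ 2)) *
      ((2 * b + 2 * s) / (q + 2 * b * s + s ^ 2))) ?_ ?_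
    · filter_upwards [hlogc.eventually hFd, hqc.eventually_ne hq0] with s hs hs'
      simp only [hqs]
      exact hs.hasDerivAt.comp s ((hqd s).log hs')
    · have hF2 : HasDerivAt (deriv F) (iteratedDeriv 2 F (Real.log q))
          (Real.log (q + 2 * b * 0 + 0 ^ 2)) := by
        have : DifferentiableAt ℝ (deriv F) (Real.log q) := by
          exact ((hF.fderiv_right (m := 1) (by norm_num)).clm_apply
            (contDiffAt_const (c := (1 : ℝ)))).differentiableAt (by simp)
        have := this.hasDerivAt
        simpa [iteratedDeriv_succ] using this
      have hq0' : q + 2 * b * 0 + 0 ^ 2 ≠ 0 := by simpa using hq0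
      have hlin : HasDerivAt (fun s : ℝ => 2 * b + 2 * s) 2 0 := by
        simpa using ((hasDerivAt_id (0 : ℝ)).const_mul 2).const_add (2 * b)
      have := (hF2.comp (0 : ℝ) ((hqd 0).log hq0')).mul (hlin.div (hqd 0) hq0')
      convert! this using 1
      simp
  rw [InnerProductSpace.laplacian_eq_iteratedFDeriv_complexPlane]
  simp only [iteratedFDeriv_two_apply, Matrix.cons_val_zero, Matrix.cons_val_one]
  rw [main 1 (by simp) z.re (by simp), main Complex.I (by simp) z.im (by simp)]
  have hsum : z.re * z.re + z.im * z.im = q := by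
    rw [hq, ← Complex.normSq_eq_norm_sq, Complex.normSq_apply]
  field_simp
  linear_combination (4 * iteratedDeriv 2 F (Real.log q) - 4 * deriv F (Real.log q)) * hsum

end SzegoMetric

namespace SzegoMetric

open ProbabilityTheory

/-! ### Even functions on a symmetric interval -/

lemma deriv_eq_zero_of_even {h : ℝ → ℝ} (heven : ∀ s, h (-s) = h s) : deriv h 0 = 0 := by
  have := deriv_comp_neg h 0
  simp only [heven, neg_zero] at this
  linarith

/-- After subtracting `c / 2 * x ^ 2` the function is convex and still even, and `0` is the midpoint
of `s` and `-s`. -/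
lemma add_half_mul_sq_le_of_even {L c : ℝ} {h : ℝ → ℝ} (hA : AnalyticOnNhd ℝ h (Ioo (-L) L))
    (heven : ∀ s, h (-s) = h s) (hc : ∀ s ∈ Ioo (-L) L, c ≤ iteratedDeriv 2 h s) {s : ℝ}
    (hs : s ∈ Ioo (-L) L) : h 0 + c / 2 * s ^ 2 ≤ h s := by
  set g : ℝ → ℝ := fun x => h x - c / 2 * x ^ 2 with hg
  have hgA : AnalyticOnNhd ℝ g (Ioo (-L) L) := fun x hx => by
    have := hA x hx
    fun_prop
  have hd1 : ∀ x ∈ Ioo (-L) L, deriv g x = deriv h x - c * x := fun x hx => by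
    have h1 : HasDerivAt g (deriv h x - c / 2 * (2 * x)) x := by
      have := (hA x hx).differentiableAt.hasDerivAt.sub ((hasDerivAt_pow 2 x).const_mul (c / 2))
      convert! this using 1
      simp
    rw [h1.deriv]; ring
  have hd2 : ∀ x ∈ Ioo (-L) L, deriv (deriv g) x = iteratedDeriv 2 h x - c := fun x hx => by
    have h1 : deriv g =ᶠ[𝓝 x] fun x => deriv h x - c * x :=
      (isOpen_Ioo.eventually_mem hx).mono hd1
    have h2 : HasDerivAt (fun x => deriv h x - c * x) (deriv (deriv h) x - c) x := by
      have := (hA x hx).deriv.differentiableAt.hasDerivAt.sub ((hasDerivAt_id x).const_mul c)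
      convert! this using 1
      simp
    rw [h1.deriv_eq, h2.deriv, iteratedDeriv_succ, iteratedDeriv_one]
  have hconv : ConvexOn ℝ (Ioo (-L) L) g := by
    refine convexOn_of_deriv2_nonneg' (convex_Ioo _ _)
      (fun x hx => (hgA x hx).differentiableAt.differentiableWithinAt)
      (fun x hx => (hgA x hx).deriv.differentiableAt.differentiableWithinAt) fun x hx => ?_
    change 0 ≤ deriv (deriv g) x
    rw [hd2 x hx]
    linarith [hc x hx]
  have hs' : -s ∈ Ioo (-L) L := ⟨by linarith [hs.2], by linarith [hs.1]⟩
  have := hconv.2 hs hs' (by norm_num : (0 : ℝ) ≤ 1 / 2)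
    (by norm_num : (0 : ℝ) ≤ 1 / 2) (by norm_num)
  simp only [hg, smul_eq_mul, heven, mul_neg, add_neg_cancel, neg_sq] at this
  linarith

lemma le_add_half_mul_sq_of_even {L c : ℝ} {h : ℝ → ℝ} (hA : AnalyticOnNhd ℝ h (Ioo (-L) L))
    (heven : ∀ s, h (-s) = h s) (hc : ∀ s ∈ Ioo (-L) L, iteratedDeriv 2 h s ≤ c) {s : ℝ}
    (hs : s ∈ Ioo (-L) L) : h s ≤ h 0 + c / 2 * s ^ 2 := by
  have := add_half_mul_sq_le_of_even (c := -c) (h := fun x => -h x) (fun x hx => (hA x hx).neg)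
    (fun x => by rw [heven]) (fun x hx => by
      rw [iteratedDeriv_fun_neg]; linarith [hc x hx]) hs
  linarith

/-! ### The bilateral exponential sum -/

/-- The weights `1 / (2 cosh ((n + 1/2) L))`. -/
noncomputable def weight (L : ℝ) (n : ℤ) : NNReal :=
  (Real.exp (L * (n + 1 / 2)) + Real.exp (-(L * (n + 1 / 2)))).toNNReal⁻¹

lemma coe_weight (L : ℝ) (n : ℤ) :
    (weight L n : ℝ) = (Real.exp (L * (n + 1 / 2)) + Real.exp (-(L * (n + 1 / 2))))⁻¹ := by
  rw [weight, NNReal.coe_inv, Real.coe_toNNReal _ (by positivity)]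

lemma weight_pos (L : ℝ) (n : ℤ) : 0 < (weight L n : ℝ) := by
  rw [coe_weight]; positivity

/-- The measure on `ℤ` with the weights `1 / (2 cosh ((n + 1/2) L))`. -/
noncomputable def weightMeasure (L : ℝ) : Measure ℤ :=
  Measure.count.withDensity fun n => (weight L n : ENNReal)

/-- The inclusion of `ℤ` into `ℝ`, shifted by `1/2`. -/
noncomputable def halfShift (n : ℤ) : ℝ := n + 1 / 2

lemma integrable_weightMeasure {L : ℝ} {g : ℤ → ℝ} :
    Integrable g (weightMeasure L) ↔ Summable fun n => weight L n * g n := by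
  rw [weightMeasure, integrable_withDensity_iff_integrable_smul (measurable_of_countable _),
    integrable_count_iff, summable_norm_iff]
  rfl

lemma integral_weightMeasure (L : ℝ) (g : ℤ → ℝ) :
    ∫ n, g n ∂(weightMeasure L) = ∑' n, weight L n * g n := by
  by_cases hg : Integrable g (weightMeasure L)
  · have hg' : Integrable (fun n => weight L n • g n) Measure.count :=
      integrable_count_iff.2 (integrable_weightMeasure.1 hg).norm
    rw [weightMeasure, integral_withDensity_eq_integral_smul (measurable_of_countable _),
      integral_countable hg']
    simp [NNReal.smul_def]
  · rw [integral_undef hg, tsum_eq_zero_of_not_summable (fun h => hg (integrable_weightMeasure.2 h))]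

/-- The exponential sum `∑ₙ exp (s (n + 1/2)) / (2 cosh ((n + 1/2) L))`. -/
noncomputable def expSum (L : ℝ) : ℝ → ℝ := mgf halfShift (weightMeasure L)

lemma expSum_eq_tsum (L s : ℝ) :
    expSum L s = ∑' n, weight L n * Real.exp (s * halfShift n) := by
  rw [expSum, mgf, integral_weightMeasure]

/-- Each bound drops one of the two exponentials in the denominator of the weight. -/
lemma weight_mul_exp_le (L s : ℝ) (n : ℤ) :
    weight L n * Real.exp (s * halfShift n) ≤ Real.exp ((s - L) * halfShift n) ∧
    weight L n * Real.exp (s * halfShift n) ≤ Real.exp ((s + L) * halfShift n) := by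
  have h1 := Real.exp_pos (L * (n + 1 / 2))
  have h2 := Real.exp_pos (-(L * (n + 1 / 2)))
  constructor
  · rw [coe_weight, inv_mul_le_iff₀ (by positivity), add_mul, ← Real.exp_add, ← Real.exp_add]
    have : L * (n + 1 / 2) + (s - L) * halfShift n = s * halfShift n := by rw [halfShift]; ring
    rw [this]
    linarith [Real.exp_pos (-(L * (n + 1 / 2)) + (s - L) * halfShift n)]
  · rw [coe_weight, inv_mul_le_iff₀ (by positivity), add_mul, ← Real.exp_add, ← Real.exp_add]
    have : -(L * (n + 1 / 2)) + (s + L) * halfShift n = s * halfShift n := by rw [halfShift]; ring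
    rw [this]
    linarith [Real.exp_pos (L * (n + 1 / 2) + (s + L) * halfShift n)]

lemma exp_mul_halfShift (x : ℝ) (n : ℤ) :
    Real.exp (x * halfShift n) = Real.exp (x / 2) * Real.exp x ^ n := by
  rw [halfShift, mul_add, Real.exp_add, mul_comm x (n : ℝ), mul_one_div, mul_comm,
    ← Real.rpow_intCast, ← Real.exp_mul, mul_comm x]

lemma summable_weight_mul_exp {L s : ℝ} (hs : s ∈ Ioo (-L) L) :
    Summable fun n => weight L n * Real.exp (s * halfShift n) := by
  have hL : 0 < L := by linarith [hs.1, hs.2]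
  refine summable_of_two_geometric_bounds (a := Real.exp (-(2 * L))) (x := Real.exp (s - L))
    (C := Real.exp L) (Real.exp_pos _) (Real.exp_lt_exp.2 (by linarith [hs.1]))
    (Real.exp_lt_one_iff.2 (by linarith [hs.2])) (fun n => ?_) (fun n => ?_)
  · rw [Real.norm_of_nonneg (mul_nonneg (weight_pos L n).le (Real.exp_pos _).le)]
    refine (weight_mul_exp_le L s n).1.trans ?_
    rw [exp_mul_halfShift]
    gcongr
    linarith [hs.2]
  · rw [Real.norm_of_nonneg (mul_nonneg (weight_pos L n).le (Real.exp_pos _).le)]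
    refine (weight_mul_exp_le L s n).2.trans ?_
    rw [exp_mul_halfShift, ← Real.exp_sub]
    have : s - L - -(2 * L) = s + L := by ring
    rw [this]
    gcongr
    linarith [hs.2]

lemma Ioo_subset_interior (L : ℝ) :
    Ioo (-L) L ⊆ interior (integrableExpSet halfShift (weightMeasure L)) :=
  isOpen_Ioo.subset_interior_iff.2 fun _ hs =>
    integrable_weightMeasure.2 (summable_weight_mul_exp hs)

lemma halfShift_sub (n : ℤ) : halfShift (-1 - n) = -halfShift n := by
  rw [halfShift, halfShift]; push_cast; ring

lemma weight_sub (L : ℝ) (n : ℤ) : weight L (-1 - n) = weight L n := by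
  have := halfShift_sub n
  simp only [halfShift] at this
  rw [weight, weight, this, mul_neg, neg_neg, add_comm]

lemma expSum_neg (L s : ℝ) : expSum L (-s) = expSum L s := by
  rw [expSum_eq_tsum, expSum_eq_tsum, ← (Equiv.subLeft (-1 : ℤ)).tsum_eq]
  simp [halfShift_sub, weight_sub]

/-- The logarithm of the bilateral exponential sum. -/
noncomputable def logExpSum (L : ℝ) : ℝ → ℝ := cgf halfShift (weightMeasure L)

lemma logExpSum_eq (L s : ℝ) : logExpSum L s = Real.log (expSum L s) := rfl

lemma logExpSum_neg (L s : ℝ) : logExpSum L (-s) = logExpSum L s := by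
  rw [logExpSum_eq, expSum_neg, logExpSum_eq]

lemma analyticOnNhd_logExpSum (L : ℝ) : AnalyticOnNhd ℝ (logExpSum L) (Ioo (-L) L) :=
  analyticOnNhd_cgf.mono (Ioo_subset_interior L)

lemma sum_le_expSum {L s : ℝ} (hs : s ∈ Ioo (-L) L) (t : Finset ℤ) :
    ∑ n ∈ t, weight L n * Real.exp (s * halfShift n) ≤ expSum L s := by
  rw [expSum_eq_tsum]
  exact (summable_weight_mul_exp hs).sum_le_tsum t fun n _ =>
    mul_nonneg (weight_pos L n).le (Real.exp_pos _).le

lemma expSum_pos {L s : ℝ} (hs : s ∈ Ioo (-L) L) : 0 < expSum L s := by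
  refine lt_of_lt_of_le ?_ (sum_le_expSum hs {0})
  simpa using (mul_pos (weight_pos L 0) (Real.exp_pos _))

/-- The second derivative of `logExpSum`. -/
noncomputable def logExpSum₂ (L : ℝ) : ℝ → ℝ := iteratedDeriv 2 (logExpSum L)

lemma logExpSum₂_neg (L s : ℝ) : logExpSum₂ L (-s) = logExpSum₂ L s := by
  have h := iteratedDeriv_comp_neg 2 (logExpSum L) s
  simp only [logExpSum_neg] at h
  simpa [logExpSum₂] using h.symm

/-- The second derivative is the variance of the exponentially tilted measure. It cannot vanish,
since the atoms at `n = 0` and `n = 1` cannot both sit at the mean. -/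
lemma logExpSum₂_pos {L s : ℝ} (hs : s ∈ Ioo (-L) L) : 0 < logExpSum₂ L s := by
  have hs' := Ioo_subset_interior L hs
  have hpow : ∀ k : ℕ, Summable fun n =>
      (weight L n : ℝ) * (halfShift n ^ k * Real.exp (s * halfShift n)) := fun k =>
    integrable_weightMeasure.1 (integrable_pow_mul_exp_of_mem_interior_integrableExpSet hs' k)
  rw [logExpSum₂, logExpSum, iteratedDeriv_two_cgf_eq_integral hs', integral_weightMeasure]
  refine div_pos ?_ (expSum_pos hs)
  set m := deriv (cgf halfShift (weightMeasure L)) s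
  have hsum : Summable fun n =>
      (weight L n : ℝ) * ((halfShift n - m) ^ 2 * Real.exp (s * halfShift n)) := by
    refine (((hpow 2).sub ((hpow 1).mul_left (2 * m))).add ((hpow 0).mul_left (m ^ 2))).congr
      fun n => ?_
    ring
  have hnn : ∀ n, 0 ≤ (weight L n : ℝ) * ((halfShift n - m) ^ 2 * Real.exp (s * halfShift n)) :=
    fun n => mul_nonneg (weight_pos L n).le (mul_nonneg (sq_nonneg _) (Real.exp_pos _).le)
  have : ∃ n : ℤ, halfShift n - m ≠ 0 := by
    by_contra! h
    have h0 := h 0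
    have h1 := h 1
    simp only [halfShift] at h0 h1
    push_cast at h0 h1
    linarith
  obtain ⟨n, hn⟩ := this
  exact hsum.tsum_pos hnn n (mul_pos (weight_pos L n) (mul_pos (by positivity) (Real.exp_pos _)))

lemma analyticOnNhd_logExpSum₂ (L : ℝ) : AnalyticOnNhd ℝ (logExpSum₂ L) (Ioo (-L) L) := by
  intro s hs
  have := (analyticOnNhd_logExpSum L s hs).iterated_deriv 2
  rwa [← iteratedDeriv_eq_iterate] at this

lemma analyticOnNhd_log_logExpSum₂ (L : ℝ) :
    AnalyticOnNhd ℝ (fun s => Real.log (logExpSum₂ L s)) (Ioo (-L) L) := fun s hs =>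
  (analyticOnNhd_logExpSum₂ L s hs).log (logExpSum₂_pos hs)

/-! ### Both signs of the second derivative of `log φ` -/

/-- By evenness the mean at `s = 0` is `0`, and every half-integer has square at least `1/4`. -/
lemma quarter_le_logExpSum₂_zero {L : ℝ} (hL : 0 < L) : 1 / 4 ≤ logExpSum₂ L 0 := by
  have h0 : (0 : ℝ) ∈ Ioo (-L) L := ⟨by linarith, hL⟩
  have h0' := Ioo_subset_interior L h0
  have hpow : ∀ k : ℕ, Summable fun n =>
      (weight L n : ℝ) * (halfShift n ^ k * Real.exp (0 * halfShift n)) := fun k =>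
    integrable_weightMeasure.1 (integrable_pow_mul_exp_of_mem_interior_integrableExpSet h0' k)
  have hd : deriv (cgf halfShift (weightMeasure L)) 0 = 0 :=
    deriv_eq_zero_of_even (logExpSum_neg L)
  rw [logExpSum₂, logExpSum, iteratedDeriv_two_cgf h0', hd, integral_weightMeasure]
  have hpos : 0 < mgf halfShift (weightMeasure L) 0 := expSum_pos h0
  have hE : mgf halfShift (weightMeasure L) 0 =
      ∑' n, (weight L n : ℝ) * Real.exp (0 * halfShift n) := expSum_eq_tsum L 0
  rw [zero_pow two_ne_zero, sub_zero,
    le_div_iff₀ hpos, hE, ← tsum_mul_left]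
  refine ((summable_weight_mul_exp h0).mul_left _).tsum_le_tsum (fun n => ?_) (hpow 2)
  have hsq : 1 / 4 ≤ halfShift n ^ 2 := by
    have : (0 : ℤ) ≤ n * (n + 1) := by
      rcases le_or_gt 0 n with h | h
      · positivity
      · nlinarith
    have : (0 : ℝ) ≤ n * (n + 1) := by exact_mod_cast this
    rw [halfShift]; nlinarith
  have hw : 0 ≤ (weight L n : ℝ) * Real.exp (0 * halfShift n) :=
    mul_nonneg (weight_pos L n).le (Real.exp_pos _).le
  nlinarith

lemma exists_pos_iteratedDeriv_two_log {L : ℝ} (hL : 0 < L) :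
    ∃ s ∈ Ioo (-L) L, 0 < iteratedDeriv 2 (fun s => Real.log (logExpSum₂ L s)) s := by
  by_contra! h
  have h0 : (0 : ℝ) ∈ Ioo (-L) L := ⟨by linarith, hL⟩
  set K := logExpSum₂ L 0
  have hK : 0 < K := logExpSum₂_pos h0
  have h1 : ∀ s ∈ Ioo (-L) L, logExpSum₂ L s ≤ K := fun s hs => by
    have := le_add_half_mul_sq_of_even (analyticOnNhd_log_logExpSum₂ L)
      (fun s => by rw [logExpSum₂_neg]) h hs
    simp only [zero_div, zero_mul, add_zero] at this
    exact (Real.log_le_log_iff (logExpSum₂_pos hs) hK).1 this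
  set B := Real.exp (logExpSum L 0 + K / 2 * L ^ 2) with hB
  have h2 : ∀ s ∈ Ioo (-L) L, expSum L s ≤ B := fun s hs => by
    rw [hB, ← Real.log_le_iff_le_exp (expSum_pos hs)]
    refine (le_add_half_mul_sq_of_even (analyticOnNhd_logExpSum L) (logExpSum_neg L) h1 hs).trans ?_
    have : s ^ 2 ≤ L ^ 2 := sq_le_sq' hs.1.le hs.2.le
    gcongr
  -- At `s = L` each term with `n ≥ 0` is at least `1/2`, so more than `2 B` of them exceed the
  -- supposed bound `B`.
  obtain ⟨N, hN⟩ := exists_nat_gt (2 * B)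
  have hsum : ∑ n ∈ (Finset.range N).map Nat.castEmbedding,
      weight L n * Real.exp (L * halfShift n) ≤ B := by
    have hcont : Continuous fun s : ℝ => ∑ n ∈ (Finset.range N).map (Nat.castEmbedding (R := ℤ)),
      weight L n * Real.exp (s * halfShift n) := by fun_prop
    have : Tendsto (fun s : ℝ => ∑ n ∈ (Finset.range N).map (Nat.castEmbedding (R := ℤ)),
      weight L n * Real.exp (s * halfShift n)) (𝓝[<] L) (𝓝 _) := hcont.continuousWithinAt.tendsto
    -- The bound is known only for `s < L`; a finite partial sum is continuous, so it extends to `s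
    -- = L`.
    refine le_of_tendsto this ?_
    filter_upwards [Ioo_mem_nhdsLT (show -L < L by linarith)] with s hs
    exact (sum_le_expSum hs _).trans (h2 s hs)
  rw [Finset.sum_map] at hsum
  have hterm : ∀ n ∈ Finset.range N, (1 / 2 : ℝ) ≤
      weight L (Nat.castEmbedding n : ℤ) * Real.exp (L * halfShift (Nat.castEmbedding n : ℤ)) := by
    intro n _
    have hp : 0 ≤ L * halfShift (n : ℤ) := by rw [halfShift]; push_cast; positivity
    have hle : Real.exp (-(L * halfShift (n : ℤ))) ≤ Real.exp (L * halfShift (n : ℤ)) :=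
      Real.exp_le_exp.2 (by linarith)
    rw [Nat.castEmbedding_apply, coe_weight, ← halfShift, le_inv_mul_iff₀ (by positivity)]
    linarith
  have := Finset.sum_le_sum hterm
  rw [Finset.sum_const, Finset.card_range, nsmul_eq_mul] at this
  linarith

lemma exp_le_half_pow {n : ℕ} {x : ℝ} (hx : x ≤ -n) : Real.exp x ≤ (1 / 2) ^ n := by
  have h2 : Real.exp (-1) ≤ 1 / 2 := by
    rw [Real.exp_neg, ← one_div]
    exact one_div_le_one_div_of_le two_pos (by linarith [Real.exp_one_gt_d9])
  calc Real.exp x ≤ Real.exp (n * (-1)) := Real.exp_le_exp.2 (by linarith)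
    _ = Real.exp (-1) ^ n := Real.exp_nat_mul _ _
    _ ≤ (1 / 2) ^ n := by gcongr

lemma weight_mul_exp_natCast_le {L s : ℝ} (hsL : s + 2 ≤ L) (n : ℕ) :
    weight L (n : ℤ) * Real.exp (s * halfShift (n : ℤ)) ≤ (1 / 2) ^ n := by
  refine (weight_mul_exp_le L s n).1.trans (exp_le_half_pow ?_)
  have : (0 : ℝ) ≤ n := n.cast_nonneg
  rw [halfShift, Int.cast_natCast]
  nlinarith

lemma weight_mul_exp_neg_le {L s : ℝ} (h0 : 0 ≤ s) (hsL : s + 2 ≤ L) (n : ℕ) :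
    weight L (-(n + 1 : ℤ)) * Real.exp (s * halfShift (-(n + 1 : ℤ))) ≤ (1 / 2) ^ n := by
  refine (weight_mul_exp_le L s _).2.trans (exp_le_half_pow ?_)
  have : (0 : ℝ) ≤ n := n.cast_nonneg
  rw [halfShift]
  push_cast
  nlinarith

/-- At distance at least `2` from `L`, the terms with `n ≥ 0` and those with `n < 0` are each
dominated by `∑ (1/2) ^ n = 2`. -/
lemma expSum_le_four {L s : ℝ} (h0 : 0 ≤ s) (hsL : s + 2 ≤ L) : expSum L s ≤ 4 := by
  have hnn : ∀ n : ℤ, 0 ≤ weight L n * Real.exp (s * halfShift n) := fun n =>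
    mul_nonneg (weight_pos L n).le (Real.exp_pos _).le
  have hS1 := Summable.of_nonneg_of_le (fun n : ℕ => hnn n) (weight_mul_exp_natCast_le hsL)
    summable_geometric_two
  have hS2 := Summable.of_nonneg_of_le (fun n : ℕ => hnn (-(n + 1)))
    (weight_mul_exp_neg_le h0 hsL) summable_geometric_two
  have e1 := hS1.tsum_le_tsum (weight_mul_exp_natCast_le hsL) summable_geometric_two
  have e2 := hS2.tsum_le_tsum (weight_mul_exp_neg_le h0 hsL) summable_geometric_two
  rw [tsum_geometric_two] at e1 e2
  rw [expSum_eq_tsum, tsum_of_nat_of_neg_add_one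
    (f := fun n : ℤ => (weight L n : ℝ) * Real.exp (s * halfShift n)) hS1 hS2]
  linarith

/-- Otherwise `E(8) ≥ E(0) e⁸`, the exponent being `(1/4) / 2 * 8²`. With `E(0) ≥ e⁻⁵ / 2` this
forces `E(8) ≥ e³ / 2 > 9`, against `E(8) ≤ 4`. -/
lemma exists_neg_iteratedDeriv_two_log :
    ∃ s ∈ Ioo (-10 : ℝ) 10, iteratedDeriv 2 (fun s => Real.log (logExpSum₂ 10 s)) s < 0 := by
  by_contra! h
  have h0 : (0 : ℝ) ∈ Ioo (-10 : ℝ) 10 := by norm_num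
  have h8 : (8 : ℝ) ∈ Ioo (-10 : ℝ) 10 := by norm_num
  have h1 : ∀ s ∈ Ioo (-10 : ℝ) 10, 1 / 4 ≤ logExpSum₂ 10 s := fun s hs => by
    have := add_half_mul_sq_le_of_even (analyticOnNhd_log_logExpSum₂ 10)
      (fun s => by rw [logExpSum₂_neg]) h hs
    simp only [zero_div, zero_mul, add_zero] at this
    exact (quarter_le_logExpSum₂_zero (by norm_num)).trans
      ((Real.log_le_log_iff (logExpSum₂_pos h0) (logExpSum₂_pos hs)).1 this)
  have h2 := add_half_mul_sq_le_of_even (analyticOnNhd_logExpSum 10) (logExpSum_neg 10) h1 h8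
  rw [logExpSum_eq, logExpSum_eq, Real.le_log_iff_exp_le (expSum_pos h8), Real.exp_add,
    Real.exp_log (expSum_pos h0)] at h2
  -- Only the `n = 0` term is kept; its weight is `1 / (e⁵ + e⁻⁵)`.
  have h3 : Real.exp (-5) / 2 ≤ expSum 10 0 := by
    refine le_trans ?_ (sum_le_expSum h0 {0})
    have : Real.exp (-5) ≤ Real.exp 5 := Real.exp_le_exp.2 (by norm_num)
    have h5 : Real.exp (-5) * Real.exp 5 = 1 := by rw [← Real.exp_add]; norm_num
    rw [Finset.sum_singleton, zero_mul, Real.exp_zero, mul_one, coe_weight]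
    norm_num
    rw [← one_div, le_div_iff₀ (by positivity)]
    nlinarith [Real.exp_pos (-5)]
  have h4 : Real.exp (-5) * Real.exp 8 = Real.exp 1 ^ 3 := by
    rw [← Real.exp_add, ← Real.exp_nat_mul]; norm_num
  have h5 : (2.7 : ℝ) ^ 3 ≤ Real.exp 1 ^ 3 := by
    gcongr
    linarith [Real.exp_one_gt_d9]
  have h6 : expSum 10 8 ≤ 4 := expSum_le_four (by norm_num) (by norm_num)
  have h7 : (1 : ℝ) / 4 / 2 * 8 ^ 2 = 8 := by norm_num
  rw [h7] at h2
  nlinarith [Real.exp_pos 8]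

end SzegoMetric

namespace SzegoMetric

/-! ### The Szegő metric of an annulus and its curvature -/

lemma mem_Ioo_of_mem_annulus {L : ℝ} {z : ℂ} (hz : z ∈ annulus (Real.exp (-L))) :
    Real.log (‖z‖ ^ 2) + L ∈ Ioo (-L) L := by
  have hz0 : 0 < ‖z‖ := (Real.exp_pos _).trans hz.1
  have h1 := Real.log_lt_log (Real.exp_pos _) hz.1
  have h2 := Real.log_lt_log hz0 hz.2
  rw [Real.log_exp] at h1
  rw [Real.log_one] at h2
  rw [Real.log_pow]
  push_cast
  constructor <;> linarith

lemma exists_mem_annulus {L s : ℝ} (hs : s ∈ Ioo (-L) L) :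
    ∃ z ∈ annulus (Real.exp (-L)), Real.log (‖z‖ ^ 2) + L = s := by
  have hn : ‖((Real.exp ((s - L) / 2) : ℝ) : ℂ)‖ = Real.exp ((s - L) / 2) := by
    rw [Complex.norm_real, Real.norm_of_nonneg (Real.exp_pos _).le]
  refine ⟨(Real.exp ((s - L) / 2) : ℝ), ⟨?_, ?_⟩, ?_⟩ <;> rw [hn]
  · exact Real.exp_lt_exp.2 (by linarith [hs.1])
  · exact Real.exp_lt_one_iff.2 (by linarith [hs.2])
  · rw [Real.log_pow, Real.log_exp]
    push_cast
    ring

/-- Factoring `e^{-L(n+1/2)}` out of `1 + r ^ (2 * n + 1)` leaves the symmetric denominator of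
`weight`. Passing from `n` to `n + 1/2` in the exponent costs the factor `e^{-t/2}`, where `t = log
|z|²`. -/
lemma szegoDiag_annulus_eq_expSum {L : ℝ} {z : ℂ} (hz : z ∈ annulus (Real.exp (-L))) :
    szegoDiag (annulus (Real.exp (-L))) z =
      unitLength⁻¹ * Real.exp (-(Real.log (‖z‖ ^ 2) / 2)) * expSum L (Real.log (‖z‖ ^ 2) + L) := by
  have hz0 : 0 < ‖z‖ := (Real.exp_pos _).trans hz.1
  rw [szegoDiag_annulus (Real.exp_pos _) hz, expSum_eq_tsum, ← tsum_mul_left]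
  congr 1
  ext n
  set t := Real.log (‖z‖ ^ 2) with ht
  have hzt : ‖z‖ ^ 2 = Real.exp t := (Real.exp_log (by positivity)).symm
  have h1 : Real.exp (-L) ^ (2 * n + 1) =
      Real.exp (-(L * (n + 1 / 2))) * Real.exp (-(L * (n + 1 / 2))) := by
    rw [← Real.rpow_intCast, ← Real.exp_mul, ← Real.exp_add]
    congr 1
    push_cast
    ring
  have h2 : Real.exp ((t + L) * halfShift n) =
      Real.exp (t / 2) * Real.exp t ^ n * Real.exp (L * (n + 1 / 2)) := by
    rw [← exp_mul_halfShift, ← Real.exp_add, halfShift]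
    congr 1
    ring
  rw [hzt, normSqZpow, h1, h2, coe_weight, Real.exp_neg (t / 2), Real.exp_neg (L * (n + 1 / 2))]
  have hU := unitLength_pos.ne'
  have ha := (Real.exp_pos (t / 2)).ne'
  have hb := Real.exp_pos (L * (n + 1 / 2))
  set b := Real.exp (L * (n + 1 / 2))
  field_simp

lemma iteratedDeriv_two_affine_add {h : ℝ → ℝ} {a b c L t : ℝ} (hh : AnalyticAt ℝ h (t + L)) :
    iteratedDeriv 2 (fun t => a + b * t + c * h (t + L)) t = c * iteratedDeriv 2 h (t + L) := by
  have hadd : Tendsto (fun x : ℝ => x + L) (𝓝 t) (𝓝 (t + L)) :=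
    (continuous_add_const L).continuousAt
  have h1 : deriv (fun t => a + b * t + c * h (t + L)) =ᶠ[𝓝 t] fun t => b + c * deriv h (t + L) := by
    filter_upwards [hadd.eventually hh.eventually_analyticAt] with x hx
    have := (((hasDerivAt_id x).const_mul b).const_add a).add
      ((hx.differentiableAt.hasDerivAt.comp_add_const x L).const_mul c)
    rw [mul_one] at this
    exact this.deriv
  rw [iteratedDeriv_succ, iteratedDeriv_one, h1.deriv_eq, iteratedDeriv_succ, iteratedDeriv_one]
  exact (((hh.deriv.differentiableAt.hasDerivAt.comp_add_const t L).const_mul c).const_add b).deriv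

/-- Used twice, for `log S` and for the logarithm of the metric density: both are functions of `log
|z|² + L` up to a harmonic term affine in `log |z|²`. -/
lemma laplacian_affine_add {f : ℂ → ℝ} {h : ℝ → ℝ} {a b c L : ℝ} {z : ℂ}
    (hz : z ∈ annulus (Real.exp (-L))) (hh : AnalyticAt ℝ h (Real.log (‖z‖ ^ 2) + L))
    (hf : ∀ w ∈ annulus (Real.exp (-L)),
      f w = a + b * Real.log (‖w‖ ^ 2) + c * h (Real.log (‖w‖ ^ 2) + L)) :
    Laplacian.laplacian f z =
      4 * (c * iteratedDeriv 2 h (Real.log (‖z‖ ^ 2) + L)) / ‖z‖ ^ 2 := by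
  have hz0 : z ≠ 0 := norm_pos_iff.1 ((Real.exp_pos _).trans hz.1)
  have he : f =ᶠ[𝓝 z] fun w => (fun t => a + b * t + c * h (t + L)) (Real.log (‖w‖ ^ 2)) :=
    ((isOpen_annulus _).eventually_mem hz).mono hf
  have hA : AnalyticAt ℝ (fun t => a + b * t + c * h (t + L)) (Real.log (‖z‖ ^ 2)) := by
    have : AnalyticAt ℝ (fun t => h (t + L)) (Real.log (‖z‖ ^ 2)) :=
      hh.comp_of_eq (g := h) (by fun_prop) rfl
    fun_prop
  rw [(InnerProductSpace.laplacian_congr_nhds he).eq_of_nhds,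
    laplacian_comp_log_norm_sq hz0 hA.contDiffAt, iteratedDeriv_two_affine_add hh]

lemma szegoMetric_annulus {L : ℝ} {z : ℂ} (hz : z ∈ annulus (Real.exp (-L))) :
    szegoMetric (annulus (Real.exp (-L))) z =
      √(logExpSum₂ L (Real.log (‖z‖ ^ 2) + L) / ‖z‖ ^ 2) := by
  have key := laplacian_affine_add (f := fun w => Real.log (szegoDiag (annulus (Real.exp (-L))) w))
    (a := -Real.log unitLength) (b := -(1 / 2)) (c := 1) hz
    (analyticOnNhd_logExpSum L _ (mem_Ioo_of_mem_annulus hz)) fun w hw => by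
      rw [szegoDiag_annulus_eq_expSum hw, Real.log_mul
        (mul_pos (inv_pos.2 unitLength_pos) (Real.exp_pos _)).ne'
        (expSum_pos (mem_Ioo_of_mem_annulus hw)).ne', Real.log_mul (inv_pos.2 unitLength_pos).ne'
        (Real.exp_pos _).ne', Real.log_inv, Real.log_exp, logExpSum_eq]
      ring
  rw [szegoMetric, key, one_mul, logExpSum₂]
  congr 1
  ring

lemma isConformalMetric_szegoMetric_annulus (L : ℝ) :
    IsConformalMetric (annulus (Real.exp (-L))) (szegoMetric (annulus (Real.exp (-L)))) := by
  have hpos : ∀ z ∈ annulus (Real.exp (-L)),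
      0 < logExpSum₂ L (Real.log (‖z‖ ^ 2) + L) / ‖z‖ ^ 2 := fun z hz =>
    div_pos (logExpSum₂_pos (mem_Ioo_of_mem_annulus hz))
      (pow_pos ((Real.exp_pos _).trans hz.1) 2)
  refine ⟨fun z hz => ?_, ?_⟩
  · rw [szegoMetric_annulus hz]
    exact Real.sqrt_pos.2 (hpos z hz)
  · refine ContDiffOn.congr (fun z hz => ContDiffAt.contDiffWithinAt ?_)
      fun z hz => szegoMetric_annulus hz
    have hn : ‖z‖ ^ 2 ≠ 0 := (pow_pos ((Real.exp_pos _).trans hz.1) 2).ne'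
    have hn2 : ContDiffAt ℝ 2 (fun w : ℂ => ‖w‖ ^ 2) z := (contDiff_norm_sq ℝ).contDiffAt
    have h1 : ContDiffAt ℝ 2 (fun w : ℂ => Real.log (‖w‖ ^ 2) + L) z :=
      (hn2.log hn).add contDiffAt_const
    have h2 : ContDiffAt ℝ 2 (logExpSum₂ L) (Real.log (‖z‖ ^ 2) + L) :=
      (analyticOnNhd_logExpSum₂ L _ (mem_Ioo_of_mem_annulus hz)).contDiffAt
    exact ((h2.comp z h1).div hn2 hn).sqrt (hpos z hz).ne'

lemma gaussianCurvature_szegoMetric_annulus {L : ℝ} {z : ℂ}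
    (hz : z ∈ annulus (Real.exp (-L))) :
    gaussianCurvature (szegoMetric (annulus (Real.exp (-L)))) z =
      -2 * iteratedDeriv 2 (fun s => Real.log (logExpSum₂ L s)) (Real.log (‖z‖ ^ 2) + L) /
        logExpSum₂ L (Real.log (‖z‖ ^ 2) + L) := by
  have hz0 : 0 < ‖z‖ := (Real.exp_pos _).trans hz.1
  have hφ := logExpSum₂_pos (mem_Ioo_of_mem_annulus hz)
  have key := laplacian_affine_add
    (f := fun w => Real.log (szegoMetric (annulus (Real.exp (-L))) w))
    (a := 0) (b := -(1 / 2)) (c := 1 / 2) hz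
    (analyticOnNhd_log_logExpSum₂ L _ (mem_Ioo_of_mem_annulus hz)) fun w hw => by
      have hw0 : 0 < ‖w‖ ^ 2 := pow_pos ((Real.exp_pos _).trans hw.1) 2
      have hφw := logExpSum₂_pos (mem_Ioo_of_mem_annulus hw)
      rw [szegoMetric_annulus hw, Real.log_sqrt (div_pos hφw hw0).le, Real.log_div hφw.ne' hw0.ne']
      ring
  rw [gaussianCurvature, key, szegoMetric_annulus hz, Real.sq_sqrt (by positivity)]
  field_simp
  ring

end SzegoMetric

theorem mainTheorem10 :
    ∃ Ω : Set ℂ, SzegoMetric.IsSmoothlyBoundedDomain Ω ∧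
      (∃ r : ℝ, 0 < r ∧ r < 1 ∧ Ω = SzegoMetric.annulus r) ∧
      SzegoMetric.IsSzegoKernel Ω (SzegoMetric.szegoKernel Ω) ∧
      SzegoMetric.IsConformalMetric Ω (SzegoMetric.szegoMetric Ω) ∧
      ∃ z ∈ Ω, ∃ w ∈ Ω,
        0 < SzegoMetric.gaussianCurvature (SzegoMetric.szegoMetric Ω) z ∧
        SzegoMetric.gaussianCurvature (SzegoMetric.szegoMetric Ω) w < 0 := by
  have h0 : 0 < Real.exp (-10) := Real.exp_pos _
  have h1 : Real.exp (-10) < 1 := Real.exp_lt_one_iff.2 (by norm_num)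
  -- The curvature has the sign opposite to `(log φ)''`, so the point where this is negative serves
  -- as `z`.
  obtain ⟨s, hs, hs'⟩ := SzegoMetric.exists_neg_iteratedDeriv_two_log
  obtain ⟨z, hz, rfl⟩ := SzegoMetric.exists_mem_annulus hs
  obtain ⟨s, ht, ht'⟩ := SzegoMetric.exists_pos_iteratedDeriv_two_log (L := 10) (by norm_num)
  obtain ⟨w, hw, rfl⟩ := SzegoMetric.exists_mem_annulus ht
  refine ⟨SzegoMetric.annulus (Real.exp (-10)), SzegoMetric.isSmoothlyBoundedDomain_annulus h0 h1,
    ⟨_, h0, h1, rfl⟩, SzegoMetric.isSzegoKernel_szegoKernel h0 h1,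
    SzegoMetric.isConformalMetric_szegoMetric_annulus 10, z, hz, w, hw, ?_, ?_⟩
  · rw [SzegoMetric.gaussianCurvature_szegoMetric_annulus hz]
    exact div_pos (by linarith) (SzegoMetric.logExpSum₂_pos hs)
  · rw [SzegoMetric.gaussianCurvature_szegoMetric_annulus hw]
    exact div_neg_of_neg_of_pos (by linarith) (SzegoMetric.logExpSum₂_pos ht)
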